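/- **Setting.** Let $T,\kappa,x_0,\sigma_S>0$, $z_0,\lambda,\bar\mu,\sigma_\mu\ge 0$, $\rho\in[-1,1]$, $p<0$, and let $\alpha,\delta:[0,T]\to[0,\infty)$ be integrable. Put $m(t)=\int_t^T \exp\big(\int_t^s(\delta(v)-\alpha(v))\,dv\big)\,ds$ and assume $x_0-\kappa t>z_0\,m(t)$ for all $t\in[0,T]$. For $0\le t\le s\le T$ let $a,b,l,w,g$ be the solutions of $$a_t=-2\gamma_1a^2-2\gamma_2a-\tfrac{\gamma_3}{2},\quad b_t=-2\gamma_1ab-2\lambda\bar\mu a-\gamma_2b,\quad l_t=-\sigma_\mu^2a-\tfrac{\gamma_1}{2}b^2-\lambda\bar\mu b,$$ $$w_t=-2(1-\rho^2)\sigma_\mu^2w^2+2\tfrac{\lambda\sigma_S+\rho\sigma_\mu}{\sigma_S}w+\tfrac1{2\sigma_S^2},\qquad g_t=\sigma_\mu^2(1-\rho^2)(w-a),$$ vanishing at $t=s$, where $\gamma_1=\frac{1-p+p\rho^2}{1-p}\sigma_\mu^2$, $\gamma_2=-\lambda+\frac{p\rho\sigma_\mu}{(1-p)\sigma_S}$,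 $\gamma_3=\frac{p}{(1-p)\sigma_S^2}$, and set $A=\frac{a}{1-p}$, $B=\frac{b}{1-p}$, $C=\frac{l-pg}{1-p}$. The indirect utility of the interior investment-consumption problem started at time $t$ with wealth $x$, habit $z$, drift $\eta$ and zero conditional variance is $$\widehat V(t,x,z,\eta)=\Big[\int_t^T(1+\delta(s)m(s))^{\frac p{p-1}}e^{A(t,s)\eta^2+B(t,s)\eta+C(t,s)}\,ds\Big]^{1-p}\,\frac{(x-m(t)z)^p}{p}.$$ After reversal of time the obstacle is $h(t,\eta)=\widehat V(T-t,\,x_0-\kappa(T-t),\,z_0,\,\eta)$. Consider $$\min\{v-h,\;v_t-\mathcal Lv\}=0\ \text{ on }(0,T]\times\mathbb R,\qquad \mathcal Lv=-\lambda(\eta-\bar\mu)v_\eta+\tfrac12\sigma_\mu^2v_{\eta\eta}.\qquad(*)$$ A function $u$ is a viscosity subsolution of $(*)$ if, for every $C^{1,2}$ function $\varphi$ and every $(t,\eta)\in(0,T]\times\mathbb R$ at which $u-\varphi$ has a local maximum relative to $(0,T]\times\mathbb R$, one has $\min\{u-h,\varphi_t-\mathcal L\varphi\}(t,\eta)\le0$;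 a viscosity supersolution is defined with local minima and $\ge 0$. **Proposition (Comparison Principle).** Let $u,v:[0,T]\times\mathbb R\to\mathbb R$ be bounded, $u$ an upper semicontinuous viscosity subsolution and $v$ a lower semicontinuous viscosity supersolution of $(*)$. If $u(0,\eta)\le v(0,\eta)$ for all $\eta\in\mathbb R$, then $u\le v$ on $(0,T]\times\mathbb R$. The same holds when $h$ is replaced by an arbitrary continuous function on $[0,T]\times\mathbb R$. -/

import Mathlib

open Set Function

noncomputable section

/-- The data of the model: horizon `T`, information cost rate `kappa`, initial wealth `x0`, initial
habit `z0`, risk aversion `p`, correlation `rho`, stock volatility `sigmaS`, the coefficients `lam`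
(mean reversion), `mubar` (mean level), `sigmaMu` (volatility) of the Ornstein-Uhlenbeck drift
`dμ = -lam (μ - mubar) dt + sigmaMu dB`, and the habit discount factors `alpha`, `delta`. -/
structure HabitModel where
  T : ℝ
  kappa : ℝ
  x0 : ℝ
  z0 : ℝ
  p : ℝ
  rho : ℝ
  sigmaS : ℝ
  lam : ℝ
  mubar : ℝ
  sigmaMu : ℝ
  alpha : ℝ → ℝ
  delta : ℝ → ℝ

/-! ### Elementary functions used to write the solutions of the Riccati equations -/

/-- `sinh (ξ h) / ξ`, with its limit value `h` at `ξ = 0`. -/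
def sinhQuot (ξ h : ℝ) : ℝ := ∫ u in (0 : ℝ)..h, Real.cosh (ξ * u)

/-- `(cosh (ξ h) - 1) / ξ ^ 2`, with its limit value `h ^ 2 / 2` at `ξ = 0`. -/
def coshQuot (ξ h : ℝ) : ℝ := ∫ u in (0 : ℝ)..h, sinhQuot ξ u

/-- `ξ = √(γ₂² - γ₁ γ₃)`. -/
def riccatiRoot (γ₁ γ₂ γ₃ : ℝ) : ℝ := Real.sqrt (γ₂ ^ 2 - γ₁ * γ₃)

/-- The denominator `cosh (ξ h) - γ₂ sinh (ξ h) / ξ`. -/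
def riccatiDen (γ₁ γ₂ γ₃ h : ℝ) : ℝ :=
  Real.cosh (riccatiRoot γ₁ γ₂ γ₃ * h) - γ₂ * sinhQuot (riccatiRoot γ₁ γ₂ γ₃) h

/-- The solution of `y' = 2 γ₁ y² + 2 γ₂ y + γ₃ / 2`, `y 0 = 0` (see `hasDerivAt_riccatiSol`). -/
def riccatiSol (γ₁ γ₂ γ₃ h : ℝ) : ℝ :=
  γ₃ / 2 * sinhQuot (riccatiRoot γ₁ γ₂ γ₃) h / riccatiDen γ₁ γ₂ γ₃ h

/-- The solution of `y' = (2 γ₁ r + γ₂) y + 2 c r`, `y 0 = 0`, where `r` is `riccatiSol`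
(see `hasDerivAt_riccatiLin`). -/
def riccatiLin (γ₁ γ₂ γ₃ c h : ℝ) : ℝ :=
  c * γ₃ * coshQuot (riccatiRoot γ₁ γ₂ γ₃) h / riccatiDen γ₁ γ₂ γ₃ h

theorem hasDerivAt_sinhQuot (ξ h : ℝ) : HasDerivAt (sinhQuot ξ) (Real.cosh (ξ * h)) h := by
  have hc : Continuous fun u : ℝ => Real.cosh (ξ * u) := by fun_prop
  exact hc.integral_hasStrictDerivAt 0 h |>.hasDerivAt

theorem hasDerivAt_coshQuot (ξ h : ℝ) : HasDerivAt (coshQuot ξ) (sinhQuot ξ h) h := by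
  have hc : Continuous (sinhQuot ξ) :=
    continuous_iff_continuousAt.2 fun x => (hasDerivAt_sinhQuot ξ x).continuousAt
  exact hc.integral_hasStrictDerivAt 0 h |>.hasDerivAt

theorem mul_sinhQuot (ξ h : ℝ) : ξ * sinhQuot ξ h = Real.sinh (ξ * h) := by
  have hc : Continuous fun u : ℝ => Real.cosh (ξ * u) * ξ := by fun_prop
  have hd : ∀ x ∈ uIcc (0 : ℝ) h,
      HasDerivAt (fun u : ℝ => Real.sinh (ξ * u)) (Real.cosh (ξ * x) * ξ) x := by
    intro x _
    have h1 : HasDerivAt (fun u : ℝ => ξ * u) ξ x := by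
      simpa using (hasDerivAt_id x).const_mul ξ
    exact h1.sinh
  have h2 := intervalIntegral.integral_eq_sub_of_hasDerivAt hd (hc.intervalIntegrable 0 h)
  rw [intervalIntegral.integral_mul_const] at h2
  simp only [mul_zero, Real.sinh_zero, sub_zero] at h2
  rw [sinhQuot, mul_comm]
  exact h2

theorem sq_mul_coshQuot (ξ h : ℝ) : ξ ^ 2 * coshQuot ξ h = Real.cosh (ξ * h) - 1 := by
  have hc : Continuous fun u : ℝ => Real.sinh (ξ * u) * ξ := by fun_prop
  have hd : ∀ x ∈ uIcc (0 : ℝ) h,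
      HasDerivAt (fun u : ℝ => Real.cosh (ξ * u)) (Real.sinh (ξ * x) * ξ) x := by
    intro x _
    have h1 : HasDerivAt (fun u : ℝ => ξ * u) ξ x := by
      simpa using (hasDerivAt_id x).const_mul ξ
    exact h1.cosh
  have h2 := intervalIntegral.integral_eq_sub_of_hasDerivAt hd (hc.intervalIntegrable 0 h)
  simp only [mul_zero, Real.cosh_zero] at h2
  rw [← h2, coshQuot, ← intervalIntegral.integral_const_mul]
  refine intervalIntegral.integral_congr fun u _ => ?_
  rw [← mul_sinhQuot]
  ring

theorem riccatiDen_pos {γ₁ γ₂ γ₃ h : ℝ} (hγ : γ₁ * γ₃ ≤ 0) (hh : 0 ≤ h) :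
    0 < riccatiDen γ₁ γ₂ γ₃ h := by
  have h1 : γ₂ ≤ riccatiRoot γ₁ γ₂ γ₃ := Real.le_sqrt_of_sq_le (by linarith)
  have h2 : 0 ≤ sinhQuot (riccatiRoot γ₁ γ₂ γ₃) h :=
    intervalIntegral.integral_nonneg hh fun u _ => (Real.cosh_pos _).le
  have h3 := mul_le_mul_of_nonneg_right h1 h2
  rw [mul_sinhQuot] at h3
  have h4 := Real.cosh_sub_sinh (riccatiRoot γ₁ γ₂ γ₃ * h)
  have h5 := Real.exp_pos (-(riccatiRoot γ₁ γ₂ γ₃ * h))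
  unfold riccatiDen
  linarith

theorem riccatiRoot_sq {γ₁ γ₂ γ₃ : ℝ} (hγ : γ₁ * γ₃ ≤ 0) :
    riccatiRoot γ₁ γ₂ γ₃ ^ 2 = γ₂ ^ 2 - γ₁ * γ₃ :=
  Real.sq_sqrt (by nlinarith [sq_nonneg γ₂])

theorem hasDerivAt_riccatiDen (γ₁ γ₂ γ₃ h : ℝ) :
    HasDerivAt (riccatiDen γ₁ γ₂ γ₃)
      (riccatiRoot γ₁ γ₂ γ₃ ^ 2 * sinhQuot (riccatiRoot γ₁ γ₂ γ₃) h
        - γ₂ * Real.cosh (riccatiRoot γ₁ γ₂ γ₃ * h)) h := by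
  have h1 : HasDerivAt (fun u : ℝ => riccatiRoot γ₁ γ₂ γ₃ * u) (riccatiRoot γ₁ γ₂ γ₃) h := by
    simpa using (hasDerivAt_id h).const_mul (riccatiRoot γ₁ γ₂ γ₃)
  have h2 := h1.cosh.sub ((hasDerivAt_sinhQuot (riccatiRoot γ₁ γ₂ γ₃) h).const_mul γ₂)
  refine h2.congr_deriv ?_
  rw [← mul_sinhQuot]
  ring

theorem hasDerivAt_riccatiSol {γ₁ γ₂ γ₃ h : ℝ} (hγ : γ₁ * γ₃ ≤ 0) (hh : 0 ≤ h) :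
    HasDerivAt (riccatiSol γ₁ γ₂ γ₃)
      (2 * γ₁ * riccatiSol γ₁ γ₂ γ₃ h ^ 2 + 2 * γ₂ * riccatiSol γ₁ γ₂ γ₃ h + γ₃ / 2) h := by
  have hD := (riccatiDen_pos (γ₂ := γ₂) hγ hh).ne'
  have h1 := ((hasDerivAt_sinhQuot (riccatiRoot γ₁ γ₂ γ₃) h).const_mul (γ₃ / 2)).div
    (hasDerivAt_riccatiDen γ₁ γ₂ γ₃ h) hD
  refine h1.congr_deriv ?_
  have hr := riccatiRoot_sq (γ₂ := γ₂) hγ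
  rw [hr]
  unfold riccatiSol
  field_simp
  unfold riccatiDen
  ring

theorem hasDerivAt_riccatiLin {γ₁ γ₂ γ₃ c h : ℝ} (hγ : γ₁ * γ₃ ≤ 0) (hh : 0 ≤ h) :
    HasDerivAt (riccatiLin γ₁ γ₂ γ₃ c)
      ((2 * γ₁ * riccatiSol γ₁ γ₂ γ₃ h + γ₂) * riccatiLin γ₁ γ₂ γ₃ c h
        + 2 * c * riccatiSol γ₁ γ₂ γ₃ h) h := by
  have hD := (riccatiDen_pos (γ₂ := γ₂) hγ hh).ne'
  have h1 := ((hasDerivAt_coshQuot (riccatiRoot γ₁ γ₂ γ₃) h).const_mul (c * γ₃)).div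
    (hasDerivAt_riccatiDen γ₁ γ₂ γ₃ h) hD
  refine h1.congr_deriv ?_
  have hr := riccatiRoot_sq (γ₂ := γ₂) hγ
  unfold riccatiSol riccatiLin
  field_simp
  unfold riccatiDen
  rw [hr]
  ring

namespace HabitModel

variable (P : HabitModel)

/-- `m(t) = ∫_t^T exp (∫_t^s (δ - α) dv) ds`, the cost of subsistence consumption. -/
def m (t : ℝ) : ℝ :=
  ∫ s in t..P.T, Real.exp (∫ v in t..s, (P.delta v - P.alpha v))

/-- The standing assumptions on the model. -/
structure Admissible : Prop where
  T_pos : 0 < P.T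
  kappa_pos : 0 < P.kappa
  x0_pos : 0 < P.x0
  z0_nonneg : 0 ≤ P.z0
  p_neg : P.p < 0
  rho_mem : P.rho ∈ Icc (-1 : ℝ) 1
  sigmaS_pos : 0 < P.sigmaS
  lam_nonneg : 0 ≤ P.lam
  mubar_nonneg : 0 ≤ P.mubar
  sigmaMu_nonneg : 0 ≤ P.sigmaMu
  alpha_nonneg : ∀ t ∈ Icc 0 P.T, 0 ≤ P.alpha t
  delta_nonneg : ∀ t ∈ Icc 0 P.T, 0 ≤ P.delta t
  alpha_int : IntervalIntegrable P.alpha MeasureTheory.volume 0 P.T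
  delta_int : IntervalIntegrable P.delta MeasureTheory.volume 0 P.T
  /-- the remaining wealth always covers the subsistence consumption -/
  budget : ∀ t ∈ Icc 0 P.T, P.z0 * P.m t < P.x0 - P.kappa * t

/-! ### The interior utility maximization problem -/

def gamma1 : ℝ := (1 - P.p + P.p * P.rho ^ 2) / (1 - P.p) * P.sigmaMu ^ 2

def gamma2 : ℝ := -P.lam + P.p * P.rho * P.sigmaMu / ((1 - P.p) * P.sigmaS)

def gamma3 : ℝ := P.p / ((1 - P.p) * P.sigmaS ^ 2)

/-- Solution of `a_t = -2 γ₁ a² - 2 γ₂ a - γ₃ / 2`, `a(s,s) = 0`. -/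
def a (t s : ℝ) : ℝ := riccatiSol P.gamma1 P.gamma2 P.gamma3 (s - t)

/-- Solution of `b_t = -2 γ₁ a b - 2 λ μbar a - γ₂ b`, `b(s,s) = 0`. -/
def b (t s : ℝ) : ℝ := riccatiLin P.gamma1 P.gamma2 P.gamma3 (P.lam * P.mubar) (s - t)

/-- Solution of `l_t = -σ_μ² a - (γ₁ / 2) b² - λ μbar b`, `l(s,s) = 0`. -/
def l (t s : ℝ) : ℝ :=
  ∫ r in t..s, (P.sigmaMu ^ 2 * P.a r s + P.gamma1 / 2 * P.b r s ^ 2 + P.lam * P.mubar * P.b r s)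

/-- Solution of
`w_t = -2 (1 - ρ²) σ_μ² w² + 2 ((λ σ_S + ρ σ_μ) / σ_S) w + 1 / (2 σ_S²)`, `w(s,s) = 0`. -/
def w (t s : ℝ) : ℝ :=
  riccatiSol ((1 - P.rho ^ 2) * P.sigmaMu ^ 2)
    (-((P.lam * P.sigmaS + P.rho * P.sigmaMu) / P.sigmaS)) (-(1 / P.sigmaS ^ 2)) (s - t)

/-- Solution of `g_t = σ_μ² (1 - ρ²) (w - a)`, `g(s,s) = 0`. -/
def g (t s : ℝ) : ℝ :=
  -∫ r in t..s, P.sigmaMu ^ 2 * (1 - P.rho ^ 2) * (P.w r s - P.a r s)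

/-- The coefficients `A`, `B`, `C` of the exponent, at a time `t` at which the conditional variance
of the drift is `0` (which is the case at the entry time). -/
def A (t s : ℝ) : ℝ := P.a t s / (1 - P.p)

/-- See `A`. -/
def B (t s : ℝ) : ℝ := P.b t s / (1 - P.p)

/-- See `A`. -/
def C (t s : ℝ) : ℝ := (P.l t s - P.p * P.g t s) / (1 - P.p)

/-- `N(t,η) = ∫_t^T (1 + δ m)^{p/(p-1)} exp (A η² + B η + C) ds`. -/
def N (t η : ℝ) : ℝ :=
  ∫ s in t..P.T, (1 + P.delta s * P.m s) ^ (P.p / (P.p - 1)) *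
    Real.exp (P.A t s * η ^ 2 + P.B t s * η + P.C t s)

/-- The indirect utility `Vhat(t, x, z, η; 0)` of investing and consuming from time `t` on, with
wealth `x`, habit `z`, drift estimate `η` and conditional variance `0` at time `t`. -/
def Vhat (t x z η : ℝ) : ℝ := P.N t η ^ (1 - P.p) * ((x - P.m t * z) ^ P.p / P.p)

/-- The obstacle after reversal of time: `Vhat` at the original time `T - t`. -/
def revObstacle (t η : ℝ) : ℝ :=
  P.Vhat (P.T - t) (P.x0 - P.kappa * (P.T - t)) P.z0 η

/-! ### Viscosity semisolutions of the time-reversed obstacle problem -/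

/-- The generator `-λ (η - μbar) ∂_η + ½ σ_μ² ∂_ηη`, as a function of the point `η` and of the
values `k`, `M` of the first and second derivative. -/
def generator (η k M : ℝ) : ℝ := -P.lam * (η - P.mubar) * k + 1 / 2 * P.sigmaMu ^ 2 * M

/-- `F(t,η,r,q,k,M) = min {r - g(t,η), q - ℒ(η,k,M)}`, for the obstacle `g`. -/
def F (g : ℝ → ℝ → ℝ) (t η r q k M : ℝ) : ℝ :=
  min (r - g t η) (q - P.generator η k M)

/-- The closed strip `[0,T] × ℝ`. -/
def closedStrip : Set (ℝ × ℝ) := Icc 0 P.T ×ˢ univ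

/-- The parabolic domain `(0,T] × ℝ`. -/
def strip : Set (ℝ × ℝ) := Ioc 0 P.T ×ˢ univ

end HabitModel

/-- Test functions of class `C^{1,2}` in `(t, η)`. -/
structure IsC12 (φ : ℝ → ℝ → ℝ) : Prop where
  cont : Continuous (uncurry φ)
  diff_t : ∀ η, Differentiable ℝ fun t => φ t η
  cont_t : Continuous fun q : ℝ × ℝ => deriv (fun t => φ t q.2) q.1
  diff_η : ∀ t, ContDiff ℝ 2 (φ t)
  cont_η : Continuous fun q : ℝ × ℝ => deriv (φ q.1) q.2
  cont_ηη : Continuous fun q : ℝ × ℝ => iteratedDeriv 2 (φ q.1) q.2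

namespace HabitModel

variable (P : HabitModel)

/-- Viscosity subsolutions of `F = 0` on `(0,T] × ℝ`: `F ≤ 0` at every point of `(0,T] × ℝ` at which
`u - φ` has a maximum relative to a neighbourhood of that point in `(0,T] × ℝ`. -/
def IsViscositySubsolution (g u : ℝ → ℝ → ℝ) : Prop :=
  ∀ φ : ℝ → ℝ → ℝ, IsC12 φ → ∀ t ∈ Ioc 0 P.T, ∀ η : ℝ,
    IsLocalMaxOn (fun q : ℝ × ℝ => u q.1 q.2 - φ q.1 q.2) P.strip (t, η) →
      P.F g t η (u t η) (deriv (fun s => φ s η) t) (deriv (φ t) η) (iteratedDeriv 2 (φ t) η) ≤ 0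

/-- Viscosity supersolutions of `F = 0` on `(0,T] × ℝ`. -/
def IsViscositySupersolution (g v : ℝ → ℝ → ℝ) : Prop :=
  ∀ φ : ℝ → ℝ → ℝ, IsC12 φ → ∀ t ∈ Ioc 0 P.T, ∀ η : ℝ,
    IsLocalMinOn (fun q : ℝ × ℝ => v q.1 q.2 - φ q.1 q.2) P.strip (t, η) →
      0 ≤ P.F g t η (v t η) (deriv (fun s => φ s η) t) (deriv (φ t) η) (iteratedDeriv 2 (φ t) η)

/-- Comparison for the problem with obstacle `g`: a bounded u.s.c. viscosity subsolution `u` and a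
bounded l.s.c. viscosity supersolution `v` which are ordered at time `0` are ordered. -/
def ComparisonPrinciple (g : ℝ → ℝ → ℝ) : Prop :=
  ∀ u v : ℝ → ℝ → ℝ,
    UpperSemicontinuousOn (uncurry u) P.closedStrip →
    LowerSemicontinuousOn (uncurry v) P.closedStrip →
    (∃ K : ℝ, ∀ t ∈ Icc 0 P.T, ∀ η : ℝ, |u t η| ≤ K) →
    (∃ K : ℝ, ∀ t ∈ Icc 0 P.T, ∀ η : ℝ, |v t η| ≤ K) →
    P.IsViscositySubsolution g u →
    P.IsViscositySupersolution g v →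
    (∀ η : ℝ, u 0 η ≤ v 0 η) →
    ∀ t ∈ Ioc 0 P.T, ∀ η : ℝ, u t η ≤ v t η

end HabitModel

end

noncomputable section

open MeasureTheory ProbabilityTheory Filter Topology

/-! ### Smooth functions of two variables -/

/-! Since ℒ is linear with an explicit semigroup, no doubling of variables is needed. Both `u` and
`v` are compared with a single monotone scheme f ↦ max(P_h f, G), where P is the Ornstein-Uhlenbeck
semigroup in Mehler form and G is the obstacle truncated to the common bound of `u` and `v`.

A supersolution lies above the obstacle (`obstacle_le_supersolution`) and above the flow of any
function below it (`ouSemigroup_le_supersolution`), so it dominates each step. A subsolution solves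
the heat inequality wherever it exceeds the obstacle; where it does not, it is at most G, and G(t+r)
is close to P_r G(t) ≤ P_r f for small r (`exists_uniform_step`). This gives
`subsolution_le_ouSemigroup`. Every error is a multiple κ of `growth`, a strict supersolution of the
heat equation. The flow carries this error without enlarging κ, so it does not accumulate over the
steps. At the end u ≤ v + 2κ `growth`, and κ tends to 0.

The flow of a merely continuous function need not be smooth, as σ_μ may vanish, so it cannot serve
directly as a test function. Trigonometric sums have explicit smooth flows, and they approximate
bounded continuous functions up to ε(1 + (η - μbar)²) (`exists_trigSpan_near`).

All this uses only continuity of the obstacle. For the utility obstacle, continuity follows from the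
closed Riccati formulas and dominated convergence. -/

theorem contDiff_uncurry_deriv_snd {φ : ℝ → ℝ → ℝ} {n : ℕ}
    (h : ContDiff ℝ (n + 1) (uncurry φ)) :
    ContDiff ℝ n (uncurry fun t η => deriv (φ t) η) := by
  have h1 : (uncurry fun t η => deriv (φ t) η) = fun q => fderiv ℝ (uncurry φ) q (0, 1) := by
    funext ⟨t, η⟩
    have h2 : HasDerivAt (fun η : ℝ => (t, η)) ((0 : ℝ), (1 : ℝ)) η :=
      (hasDerivAt_const η t).prodMk (hasDerivAt_id η)
    have h3 := (h.differentiable (by simp) (t, η)).hasFDerivAt.comp_hasDerivAt η h2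
    exact h3.deriv
  rw [h1]
  exact (h.fderiv_right (m := n) le_rfl).clm_apply contDiff_const

theorem continuous_deriv_fst {φ : ℝ → ℝ → ℝ} (h : ContDiff ℝ 1 (uncurry φ)) :
    Continuous fun q : ℝ × ℝ => deriv (fun t => φ t q.2) q.1 := by
  have h1 : (fun q : ℝ × ℝ => deriv (fun t => φ t q.2) q.1) =
      fun q => fderiv ℝ (uncurry φ) q (1, 0) := by
    funext ⟨t, η⟩
    have h2 : HasDerivAt (fun t : ℝ => (t, η)) ((1 : ℝ), (0 : ℝ)) t :=
      (hasDerivAt_id t).prodMk (hasDerivAt_const t η)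
    have h3 := (h.differentiable (by simp) (t, η)).hasFDerivAt.comp_hasDerivAt t h2
    exact h3.deriv
  rw [h1]
  exact (h.continuous_fderiv (by simp)).clm_apply continuous_const

theorem contDiff_slice_fst {φ : ℝ → ℝ → ℝ} {n : WithTop ℕ∞} (h : ContDiff ℝ n (uncurry φ)) (η : ℝ) :
    ContDiff ℝ n fun t => φ t η :=
  h.comp (contDiff_id.prodMk contDiff_const)

theorem contDiff_slice_snd {φ : ℝ → ℝ → ℝ} {n : WithTop ℕ∞} (h : ContDiff ℝ n (uncurry φ)) (t : ℝ) :
    ContDiff ℝ n (φ t) :=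
  h.comp (contDiff_const.prodMk contDiff_id)

theorem IsC12.of_contDiff {φ : ℝ → ℝ → ℝ} (h : ContDiff ℝ 2 (uncurry φ)) : IsC12 φ where
  cont := h.continuous
  diff_t η := (contDiff_slice_fst h η).differentiable (by simp)
  cont_t := continuous_deriv_fst (h.of_le (by norm_num))
  diff_η t := contDiff_slice_snd h t
  cont_η := (contDiff_uncurry_deriv_snd (n := 1) (by exact_mod_cast h)).continuous
  cont_ηη := by
    have h1 := contDiff_uncurry_deriv_snd (n := 1) (φ := φ) (by exact_mod_cast h)
    have h2 := contDiff_uncurry_deriv_snd (n := 0) (φ := fun t η => deriv (φ t) η)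
      (by exact_mod_cast h1)
    simp only [iteratedDeriv_succ, iteratedDeriv_zero]
    exact h2.continuous

namespace HabitModel

variable (P : HabitModel)

/-! ### The parabolic operator -/

/-- `φ_t - ℒ φ`. -/
def heatOp (φ : ℝ → ℝ → ℝ) (t η : ℝ) : ℝ :=
  deriv (fun s => φ s η) t - P.generator η (deriv (φ t) η) (iteratedDeriv 2 (φ t) η)

theorem heatOp_add {φ ψ : ℝ → ℝ → ℝ} (hφ : ContDiff ℝ 2 (uncurry φ))
    (hψ : ContDiff ℝ 2 (uncurry ψ)) (t η : ℝ) :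
    P.heatOp (fun t η => φ t η + ψ t η) t η = P.heatOp φ t η + P.heatOp ψ t η := by
  have h1 : deriv (fun s => φ s η + ψ s η) t = deriv (fun s => φ s η) t + deriv (fun s => ψ s η) t :=
    deriv_fun_add ((contDiff_slice_fst hφ η).differentiable (by simp) t)
      ((contDiff_slice_fst hψ η).differentiable (by simp) t)
  have h2 : deriv (fun y => φ t y + ψ t y) η = deriv (φ t) η + deriv (ψ t) η :=
    deriv_fun_add ((contDiff_slice_snd hφ t).differentiable (by simp) η)
      ((contDiff_slice_snd hψ t).differentiable (by simp) η)
  have h3 : iteratedDeriv 2 (fun y => φ t y + ψ t y) η =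
      iteratedDeriv 2 (φ t) η + iteratedDeriv 2 (ψ t) η :=
    iteratedDeriv_fun_add (contDiff_slice_snd hφ t).contDiffAt (contDiff_slice_snd hψ t).contDiffAt
  simp only [heatOp, generator, h1, h2, h3]
  ring

theorem heatOp_const_mul (φ : ℝ → ℝ → ℝ) (c t η : ℝ) :
    P.heatOp (fun t η => c * φ t η) t η = c * P.heatOp φ t η := by
  have h3 : iteratedDeriv 2 (fun y => c * φ t y) η = c * iteratedDeriv 2 (φ t) η :=
    iteratedDeriv_const_mul_field c (φ t)
  simp only [heatOp, generator, h3, deriv_const_mul_field]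
  ring

theorem heatOp_shift (φ : ℝ → ℝ → ℝ) (t₀ t η : ℝ) :
    P.heatOp (fun t η => φ (t - t₀) η) t η = P.heatOp φ (t - t₀) η := by
  have h1 : deriv (fun s => φ (s - t₀) η) t = deriv (fun s => φ s η) (t - t₀) :=
    deriv_comp_sub_const (fun s => φ s η) t₀ t
  simp only [heatOp, h1]

theorem heatOp_fun_fst (f : ℝ → ℝ) (t η : ℝ) : P.heatOp (fun t _ => f t) t η = deriv f t := by
  have : iteratedDeriv 2 (fun _ : ℝ => f t) η = 0 := by
    simp [iteratedDeriv_succ]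
  simp [heatOp, generator, this]

theorem contDiff_shift {φ : ℝ → ℝ → ℝ} (h : ContDiff ℝ 2 (uncurry φ)) (t₀ : ℝ) :
    ContDiff ℝ 2 (uncurry fun t η => φ (t - t₀) η) :=
  h.comp ((contDiff_fst.sub contDiff_const).prodMk contDiff_snd)

/-! ### The growth function -/

/-- A strict classical supersolution with quadratic growth. -/
def growth (t η : ℝ) : ℝ := Real.exp ((P.sigmaMu ^ 2 + 1) * t) * (1 + (η - P.mubar) ^ 2)

theorem contDiff_growth : ContDiff ℝ 2 (uncurry P.growth) := by
  unfold growth uncurry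
  fun_prop

/-- With y = η - μbar, the rate σ_μ² + 1 pays for the diffusion term σ_μ² and leaves 1 + (σ_μ² +
1)y²; mean reversion contributes the further nonnegative term 2λy². -/
theorem heatOp_growth (hl : 0 ≤ P.lam) (t η : ℝ) : 0 < P.heatOp P.growth t η := by
  set C := P.sigmaMu ^ 2 + 1 with hC
  have h1 : HasDerivAt (fun s => P.growth s η) (Real.exp (C * t) * C * (1 + (η - P.mubar) ^ 2)) t := by
    have := (((hasDerivAt_id t).const_mul C).exp).mul_const (1 + (η - P.mubar) ^ 2)
    simpa [growth] using this
  have h2 : ∀ y, HasDerivAt (P.growth t) (Real.exp (C * t) * (2 * (y - P.mubar))) y := by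
    intro y
    have := ((((hasDerivAt_id y).sub_const P.mubar).pow 2).const_add 1).const_mul (Real.exp (C * t))
    exact this.congr_deriv (by simp)
  have h3 : deriv (P.growth t) = fun y => Real.exp (C * t) * (2 * (y - P.mubar)) :=
    funext fun y => (h2 y).deriv
  have h4 : HasDerivAt (fun y => Real.exp (C * t) * (2 * (y - P.mubar))) (Real.exp (C * t) * 2) η := by
    have := (((hasDerivAt_id η).sub_const P.mubar).const_mul 2).const_mul (Real.exp (C * t))
    simpa using this
  have h5 : P.heatOp P.growth t η =
      Real.exp (C * t) * (1 + C * (η - P.mubar) ^ 2 + 2 * P.lam * (η - P.mubar) ^ 2) := by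
    simp only [heatOp, generator, iteratedDeriv_succ, iteratedDeriv_zero, h1.deriv, h3, h4.deriv]
    rw [hC]
    ring
  rw [h5]
  positivity

theorem growth_ge {t : ℝ} (ht : 0 ≤ t) (η : ℝ) : 1 + (η - P.mubar) ^ 2 ≤ P.growth t η := by
  have h1 : 1 ≤ Real.exp ((P.sigmaMu ^ 2 + 1) * t) := Real.one_le_exp (by positivity)
  have h2 : 0 ≤ 1 + (η - P.mubar) ^ 2 := by positivity
  unfold growth
  nlinarith

theorem one_le_growth {t : ℝ} (ht : 0 ≤ t) (η : ℝ) : 1 ≤ P.growth t η := by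
  have := P.growth_ge ht η
  nlinarith [sq_nonneg (η - P.mubar)]

theorem growth_mono {s t : ℝ} (h : s ≤ t) (η : ℝ) : P.growth s η ≤ P.growth t η := by
  unfold growth
  gcongr

/-! ### The Ornstein-Uhlenbeck semigroup -/

/-- Mean at time `r` of the Ornstein-Uhlenbeck process started at `η`. -/
def ouMean (r η : ℝ) : ℝ := P.mubar + Real.exp (-P.lam * r) * (η - P.mubar)

/-- Variance at time `r` of the Ornstein-Uhlenbeck process. -/
def ouVar (r : ℝ) : ℝ := ∫ u in (0 : ℝ)..r, P.sigmaMu ^ 2 * Real.exp (-2 * P.lam * u)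

/-- The transition semigroup of the Ornstein-Uhlenbeck process. -/
def ouSemigroup (f : ℝ → ℝ) (r η : ℝ) : ℝ :=
  ∫ z, f (P.ouMean r η + Real.sqrt (P.ouVar r) * z) ∂gaussianReal 0 1

theorem hasDerivAt_ouVar (r : ℝ) :
    HasDerivAt P.ouVar (P.sigmaMu ^ 2 * Real.exp (-2 * P.lam * r)) r := by
  have hc : Continuous fun u : ℝ => P.sigmaMu ^ 2 * Real.exp (-2 * P.lam * u) := by fun_prop
  exact hc.integral_hasStrictDerivAt 0 r |>.hasDerivAt

theorem contDiff_ouVar : ContDiff ℝ 2 P.ouVar := by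
  have h := (contDiff_succ_iff_deriv (𝕜 := ℝ) (n := 1) (f := P.ouVar)).2
    ⟨fun r => (P.hasDerivAt_ouVar r).differentiableAt, by simp, by
      have : deriv P.ouVar = fun r => P.sigmaMu ^ 2 * Real.exp (-2 * P.lam * r) :=
        funext fun r => (P.hasDerivAt_ouVar r).deriv
      rw [this]
      fun_prop⟩
  exact_mod_cast h

theorem ouVar_nonneg {r : ℝ} (hr : 0 ≤ r) : 0 ≤ P.ouVar r :=
  intervalIntegral.integral_nonneg hr fun u _ => by positivity

theorem ouVar_le (hl : 0 ≤ P.lam) {r : ℝ} (hr : 0 ≤ r) : P.ouVar r ≤ P.sigmaMu ^ 2 * r := by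
  have h : P.ouVar r ≤ ∫ _ in (0 : ℝ)..r, P.sigmaMu ^ 2 := by
    refine intervalIntegral.integral_mono_on hr (Continuous.intervalIntegrable (by fun_prop) _ _)
      (by simp) fun u hu => ?_
    have : Real.exp (-2 * P.lam * u) ≤ 1 := Real.exp_le_one_iff.2 (by nlinarith [hu.1, mul_nonneg hl hu.1])
    nlinarith [sq_nonneg P.sigmaMu]
  simpa [mul_comm] using h

theorem ouVar_zero : P.ouVar 0 = 0 := by simp [ouVar]

theorem ouMean_zero (η : ℝ) : P.ouMean 0 η = η := by simp [ouMean]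

theorem ouSemigroup_zero (f : ℝ → ℝ) (η : ℝ) : P.ouSemigroup f 0 η = f η := by
  simp [ouSemigroup, ouVar_zero, ouMean_zero]

theorem continuous_ouMean : Continuous (uncurry P.ouMean) := by
  unfold ouMean uncurry
  fun_prop

theorem continuous_sqrt_ouVar : Continuous fun r => Real.sqrt (P.ouVar r) :=
  P.contDiff_ouVar.continuous.sqrt

variable {P} in
theorem integrable_ouSemigroup {f : ℝ → ℝ} (hf : Continuous f) {K : ℝ} (hK : ∀ η, |f η| ≤ K)
    (r η : ℝ) :
    Integrable (fun z => f (P.ouMean r η + Real.sqrt (P.ouVar r) * z)) (gaussianReal 0 1) :=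
  Integrable.of_bound (by fun_prop) K (ae_of_all _ fun z => by simpa using hK _)

variable {P} in
theorem abs_ouSemigroup_le {f : ℝ → ℝ} {K : ℝ} (hK : ∀ η, |f η| ≤ K) (r η : ℝ) :
    |P.ouSemigroup f r η| ≤ K := by
  have h := norm_integral_le_of_norm_le_const (μ := gaussianReal 0 1)
    (f := fun z => f (P.ouMean r η + Real.sqrt (P.ouVar r) * z)) (C := K)
    (ae_of_all _ fun z => by simpa using hK _)
  simpa [ouSemigroup] using h

variable {P} in
theorem ouSemigroup_mono {f g : ℝ → ℝ} (hf : Continuous f) (hg : Continuous g) {K L : ℝ}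
    (hK : ∀ η, |f η| ≤ K) (hL : ∀ η, |g η| ≤ L) (h : ∀ η, f η ≤ g η) (r η : ℝ) :
    P.ouSemigroup f r η ≤ P.ouSemigroup g r η :=
  integral_mono (integrable_ouSemigroup hf hK r η) (integrable_ouSemigroup hg hL r η)
    fun _ => h _

/-- Joint continuity of the semigroup, for a family of functions depending on a parameter. -/
theorem continuous_ouSemigroup {F : ℝ → ℝ → ℝ} (hF : Continuous (uncurry F)) {K : ℝ}
    (hK : ∀ t η, |F t η| ≤ K) :
    Continuous fun q : ℝ × ℝ × ℝ => P.ouSemigroup (F q.1) q.2.1 q.2.2 := by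
  unfold ouSemigroup
  have h1 := P.continuous_sqrt_ouVar
  have h2 := P.continuous_ouMean
  refine continuous_of_dominated (bound := fun _ => K) (fun q => ?_) (fun q => ?_) (by simp) ?_
  · have h3 : Continuous (F q.1) := hF.comp (by fun_prop : Continuous fun η => (q.1, η))
    exact Continuous.aestronglyMeasurable (by fun_prop)
  · exact ae_of_all _ fun z => by simpa using hK _ _
  · refine ae_of_all _ fun z => ?_
    have h3 : Continuous fun q : ℝ × ℝ × ℝ => P.ouMean q.2.1 q.2.2 :=
      h2.comp (by fun_prop : Continuous fun q : ℝ × ℝ × ℝ => (q.2.1, q.2.2))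
    have h4 : Continuous fun q : ℝ × ℝ × ℝ => Real.sqrt (P.ouVar q.2.1) :=
      h1.comp (by fun_prop : Continuous fun q : ℝ × ℝ × ℝ => q.2.1)
    exact hF.comp (by fun_prop : Continuous fun q : ℝ × ℝ × ℝ =>
      (q.1, P.ouMean q.2.1 q.2.2 + Real.sqrt (P.ouVar q.2.1) * z))

/-! ### Gaussian moments and propagation of quadratically weighted errors. -/

theorem integral_sq_gaussian : ∫ z, z ^ 2 ∂gaussianReal 0 1 = 1 := by
  have h := variance_fun_id_gaussianReal (μ := 0) (v := 1)
  rw [variance_eq_integral (by fun_prop)] at h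
  simpa using h

theorem integrable_sq_gaussian : Integrable (fun z : ℝ => z ^ 2) (gaussianReal 0 1) :=
  (memLp_id_gaussianReal (μ := 0) (v := 1) 2).integrable_sq

theorem integrable_id_gaussian : Integrable (fun z : ℝ => z) (gaussianReal 0 1) :=
  (memLp_id_gaussianReal (μ := 0) (v := 1) 1).integrable le_rfl

theorem integrable_quadratic (r η : ℝ) :
    Integrable (fun z => 1 + (P.ouMean r η + Real.sqrt (P.ouVar r) * z - P.mubar) ^ 2)
      (gaussianReal 0 1) := by
  have h : (fun z => 1 + (P.ouMean r η + Real.sqrt (P.ouVar r) * z - P.mubar) ^ 2) = fun z =>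
      (1 + (P.ouMean r η - P.mubar) ^ 2) +
        (2 * (P.ouMean r η - P.mubar) * Real.sqrt (P.ouVar r) * z +
          Real.sqrt (P.ouVar r) ^ 2 * z ^ 2) := by
    funext z; ring
  rw [h]
  exact (integrable_const _).add ((integrable_id_gaussian.const_mul _).add
    (integrable_sq_gaussian.const_mul _))

/-- Mean reversion contracts the displacement from μbar and the variance is at most σ_μ² r; the
exponential in `growth` absorbs the latter. -/
theorem ouSemigroup_quadratic_le (hl : 0 ≤ P.lam) {r : ℝ} (hr : 0 ≤ r) (η : ℝ) :
    P.ouSemigroup (fun y => 1 + (y - P.mubar) ^ 2) r η ≤ P.growth r η := by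
  have h : (fun z => 1 + (P.ouMean r η + Real.sqrt (P.ouVar r) * z - P.mubar) ^ 2) = fun z =>
      (1 + (P.ouMean r η - P.mubar) ^ 2) +
        (2 * (P.ouMean r η - P.mubar) * Real.sqrt (P.ouVar r) * z +
          Real.sqrt (P.ouVar r) ^ 2 * z ^ 2) := by
    funext z; ring
  have h1 : P.ouSemigroup (fun y => 1 + (y - P.mubar) ^ 2) r η =
      1 + (P.ouMean r η - P.mubar) ^ 2 + P.ouVar r := by
    unfold ouSemigroup
    have hi : Integrable (fun z => 2 * (P.ouMean r η - P.mubar) * Real.sqrt (P.ouVar r) * z +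
          Real.sqrt (P.ouVar r) ^ 2 * z ^ 2) (gaussianReal 0 1) :=
      (integrable_id_gaussian.const_mul _).add (integrable_sq_gaussian.const_mul _)
    rw [h, integral_add (integrable_const _) hi, integral_add (integrable_id_gaussian.const_mul _)
      (integrable_sq_gaussian.const_mul _), integral_const_mul, integral_const_mul,
      integral_sq_gaussian, integral_id_gaussianReal, Real.sq_sqrt (P.ouVar_nonneg hr)]
    simp
  have h2 := P.ouVar_le hl hr
  have h3 := Real.add_one_le_exp ((P.sigmaMu ^ 2 + 1) * r)
  have h4 : Real.exp (-P.lam * r) ≤ 1 := Real.exp_le_one_iff.2 (by nlinarith [mul_nonneg hl hr])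
  have h5 := Real.exp_pos (-P.lam * r)
  have h6 : (P.ouMean r η - P.mubar) ^ 2 ≤ (η - P.mubar) ^ 2 := by
    have : P.ouMean r η - P.mubar = Real.exp (-P.lam * r) * (η - P.mubar) := by
      unfold ouMean; ring
    rw [this, mul_pow]
    have : Real.exp (-P.lam * r) ^ 2 ≤ 1 := by nlinarith
    nlinarith [sq_nonneg (η - P.mubar)]
  rw [h1]
  unfold growth
  have h7 : 0 ≤ (P.sigmaMu ^ 2 + 1) * r := by positivity
  nlinarith [sq_nonneg (η - P.mubar), mul_nonneg (sub_nonneg.2 h3) (sq_nonneg (η - P.mubar)),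
    mul_nonneg h7 (sq_nonneg (η - P.mubar))]

variable {P} in
-- Transfers the error of a trigonometric approximation from the initial data to the flow.
theorem ouSemigroup_le_add {f g : ℝ → ℝ} (hf : Continuous f) (hg : Continuous g) {K L ε : ℝ}
    (hl : 0 ≤ P.lam) (hε : 0 ≤ ε)
    (hK : ∀ η, |f η| ≤ K) (hL : ∀ η, |g η| ≤ L) (h : ∀ η, f η ≤ g η + ε * (1 + (η - P.mubar) ^ 2))
    {r : ℝ} (hr : 0 ≤ r) (η : ℝ) :
    P.ouSemigroup f r η ≤ P.ouSemigroup g r η + ε * P.growth r η := by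
  have h1 := integrable_ouSemigroup (P := P) hf hK r η
  have h2 := integrable_ouSemigroup (P := P) hg hL r η
  have h3 := (P.integrable_quadratic r η).const_mul ε
  have h4 := integral_mono h1 (h2.add h3) fun z => h _
  have h5 := mul_le_mul_of_nonneg_left (P.ouSemigroup_quadratic_le hl hr η) hε
  simp only [Pi.add_apply] at h4
  rw [integral_add h2 h3, integral_const_mul] at h4
  exact h4.trans (add_le_add_right h5 _)

end HabitModel

/-! ### Trigonometric sums -/

/-- Linear combinations of the functions `x ↦ cos (k x + b)`. -/
def trigSpan : Submodule ℝ (ℝ → ℝ) :=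
  Submodule.span ℝ (range fun q : ℝ × ℝ => fun x => Real.cos (q.1 * x + q.2))

theorem cos_mem_trigSpan (k b : ℝ) : (fun x => Real.cos (k * x + b)) ∈ trigSpan :=
  Submodule.subset_span ⟨(k, b), rfl⟩

theorem cos_mul_mem_trigSpan (k b : ℝ) {f : ℝ → ℝ} (hf : f ∈ trigSpan) :
    (fun x => Real.cos (k * x + b) * f x) ∈ trigSpan := by
  unfold trigSpan at hf
  induction hf using Submodule.span_induction with
  | mem f hf =>
    obtain ⟨⟨k', b'⟩, rfl⟩ := hf
    have h : (fun x => Real.cos (k * x + b) * Real.cos (k' * x + b')) =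
        (1 / 2 : ℝ) • ((fun x => Real.cos ((k + k') * x + (b + b'))) +
          fun x => Real.cos ((k - k') * x + (b - b'))) := by
      funext x
      have h1 : (k + k') * x + (b + b') = (k * x + b) + (k' * x + b') := by ring
      have h2 : (k - k') * x + (b - b') = (k * x + b) - (k' * x + b') := by ring
      simp only [Pi.smul_apply, Pi.add_apply, smul_eq_mul, h1, h2, Real.cos_add (k * x + b),
        Real.cos_sub (k * x + b)]
      ring
    rw [h]
    exact trigSpan.smul_mem _ (trigSpan.add_mem (cos_mem_trigSpan _ _) (cos_mem_trigSpan _ _))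
  | zero =>
    have h : (fun x => Real.cos (k * x + b) * (0 : ℝ → ℝ) x) = 0 := by
      funext x; simp
    rw [h]
    exact trigSpan.zero_mem
  | add f g _ _ h1 h2 =>
    have h : (fun x => Real.cos (k * x + b) * (f + g) x) =
        (fun x => Real.cos (k * x + b) * f x) + fun x => Real.cos (k * x + b) * g x := by
      funext x; simp [mul_add]
    rw [h]
    exact trigSpan.add_mem h1 h2
  | smul c f _ h1 =>
    have h : (fun x => Real.cos (k * x + b) * (c • f) x) =
        c • fun x => Real.cos (k * x + b) * f x := by
      funext x; simp; ring
    rw [h]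
    exact trigSpan.smul_mem _ h1

theorem polynomial_sin_mem_trigSpan (p : Polynomial ℝ) (k : ℝ) :
    (fun x => p.eval (Real.sin (k * x))) ∈ trigSpan := by
  have hs : ∀ x, Real.sin (k * x) = Real.cos (k * x + -(Real.pi / 2)) := fun x => by
    rw [← sub_eq_add_neg, Real.cos_sub_pi_div_two]
  have hpow : ∀ n : ℕ, (fun x => Real.sin (k * x) ^ n) ∈ trigSpan := by
    intro n
    induction n with
    | zero => simpa using cos_mem_trigSpan 0 0
    | succ n ih =>
      have h := cos_mul_mem_trigSpan k (-(Real.pi / 2)) ih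
      simpa only [← hs, ← pow_succ'] using h
  have h : (fun x => p.eval (Real.sin (k * x))) =
      ∑ i ∈ Finset.range (p.natDegree + 1), p.coeff i • fun x => Real.sin (k * x) ^ i := by
    funext x
    simp [Polynomial.eval_eq_sum_range]
  rw [h]
  exact trigSpan.sum_mem fun i _ => trigSpan.smul_mem _ (hpow i)

/-- Weierstrass applied to s ↦ f(R arcsin s) on [-1,1] yields a polynomial in sin(x/R) close to f
for |x| ≤ Rπ/2. Farther out both functions are bounded and the quadratic weight takes over. -/
theorem exists_trigSpan_near {f : ℝ → ℝ} (hf : Continuous f) {K : ℝ} (hK : ∀ x, |f x| ≤ K) (c : ℝ)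
    {ε : ℝ} (hε : 0 < ε) :
    ∃ f' ∈ trigSpan, ∀ x, |f x - f' x| ≤ ε * (1 + (x - c) ^ 2) := by
  have hK0 : 0 ≤ K := (abs_nonneg _).trans (hK 0)
  -- For |x| > R this forces ε(x - c)² ≥ 2K, so the weight covers the crude bound K + (K + ε).
  set R := |c| + (2 * K / ε + 1) with hR
  have hq : 0 ≤ 2 * K / ε := by positivity
  have hR0 : 0 < R := by positivity
  obtain ⟨p, hp⟩ := exists_polynomial_near_of_continuousOn (-1) 1 (fun s => f (R * Real.arcsin s))
    (hf.comp (Real.continuous_arcsin.const_mul R)).continuousOn ε hε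
  refine ⟨_, polynomial_sin_mem_trigSpan p R⁻¹, fun x => ?_⟩
  have h1 := hp (Real.sin (R⁻¹ * x)) ⟨Real.neg_one_le_sin _, Real.sin_le_one _⟩
  by_cases hx : |R⁻¹ * x| ≤ Real.pi / 2
  · rw [abs_le] at hx
    rw [Real.arcsin_sin hx.1 hx.2, mul_inv_cancel_left₀ hR0.ne'] at h1
    rw [abs_sub_comm]
    nlinarith [sq_nonneg (x - c), mul_nonneg hε.le (sq_nonneg (x - c))]
  · have h2 : 1 < |R⁻¹ * x| := by
      have := Real.pi_gt_three
      linarith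
    rw [abs_mul, abs_of_pos (inv_pos.2 hR0), inv_mul_eq_div, one_lt_div hR0] at h2
    have h3 : 2 * K / ε + 1 ≤ |x - c| := by
      have := abs_sub_abs_le_abs_sub x c
      linarith
    have h4 : 2 * K / ε ≤ (x - c) ^ 2 := by
      rw [← sq_abs]
      nlinarith
    rw [div_le_iff₀ hε] at h4
    have h5 := hK x
    have h6 := hK (R * Real.arcsin (Real.sin (R⁻¹ * x)))
    rw [abs_le] at h5 h6 ⊢
    rw [abs_lt] at h1
    constructor <;> nlinarith

namespace HabitModel

variable (P : HabitModel)

/-! ### Explicit classical solutions -/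

/-- The semigroup started at `f` is the restriction to `t ≥ 0` of a smooth global solution. -/
structure HasClassicalFlow (f : ℝ → ℝ) : Prop where
  continuous : Continuous f
  bounded : ∃ K, ∀ η, |f η| ≤ K
  exists_flow : ∃ W : ℝ → ℝ → ℝ, ContDiff ℝ 2 (uncurry W) ∧ (∀ t η, P.heatOp W t η = 0) ∧
    ∀ r, 0 ≤ r → ∀ η, W r η = P.ouSemigroup f r η

/-- Real part of the Gaussian characteristic function, rotated by the phase c. -/
theorem integral_cos_gaussian (c s : ℝ) :
    ∫ z, Real.cos (c + s * z) ∂gaussianReal 0 1 = Real.cos c * Real.exp (-(s ^ 2 / 2)) := by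
  have h := charFun_gaussianReal (μ := 0) (v := 1) s
  rw [charFun_apply_real] at h
  have h1 : ∀ z : ℝ, Complex.exp ((c + s * z : ℝ) * Complex.I) =
      Complex.exp (c * Complex.I) * Complex.exp (s * z * Complex.I) := fun z => by
    rw [← Complex.exp_add]
    push_cast
    ring_nf
  have h2 : ∫ z, Complex.exp ((c + s * z : ℝ) * Complex.I) ∂gaussianReal 0 1 =
      Complex.exp (c * Complex.I) * Complex.exp ((-(s ^ 2 / 2) : ℝ)) := by
    simp only [h1]
    rw [integral_const_mul, h]
    congr 2
    push_cast
    ring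
  have hi : Integrable (fun z : ℝ => Complex.exp ((c + s * z : ℝ) * Complex.I)) (gaussianReal 0 1) :=
    Integrable.of_bound (Continuous.aestronglyMeasurable (by fun_prop)) 1
      (ae_of_all _ fun z => by rw [Complex.norm_exp_ofReal_mul_I])
  have h3 := integral_re (𝕜 := ℂ) hi
  rw [h2] at h3
  simp only [RCLike.re_to_complex, Complex.exp_ofReal_mul_I_re] at h3
  rw [h3, ← Complex.ofReal_exp, Complex.re_mul_ofReal, Complex.exp_ofReal_mul_I_re]

theorem hasClassicalFlow_cos (k b : ℝ) :
    P.HasClassicalFlow fun x => Real.cos (k * x + b) where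
  continuous := by fun_prop
  bounded := ⟨1, fun η => Real.abs_cos_le_one _⟩
  exists_flow := by
    -- Only the variance enters, not its square root, so the formula is smooth for all real t,
    -- including t ≤ 0 and the case σ_μ = 0.
    refine ⟨fun t η => Real.cos (k * P.ouMean t η + b) * Real.exp (-(k ^ 2 * P.ouVar t / 2)),
      ?_, fun t η => ?_, fun r hr η => ?_⟩
    · have h1 : ContDiff ℝ 2 fun q : ℝ × ℝ => P.ouVar q.1 := P.contDiff_ouVar.comp contDiff_fst
      unfold ouMean uncurry
      fun_prop
    · set E := Real.exp (-P.lam * t) with hE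
      have hm_t : HasDerivAt (fun s => k * P.ouMean s η + b) (k * (E * -P.lam * (η - P.mubar))) t := by
        have := ((((((hasDerivAt_id t).const_mul (-P.lam)).exp).mul_const (η - P.mubar)).const_add
          P.mubar).const_mul k).add_const b
        exact this.congr_deriv (by simp [hE])
      have hm_η : ∀ y, HasDerivAt (fun y => k * P.ouMean t y + b) (k * E) y := fun y => by
        have := (((((hasDerivAt_id y).sub_const P.mubar).const_mul E).const_add
          P.mubar).const_mul k).add_const b
        exact this.congr_deriv (by simp)
      have hS : HasDerivAt (fun s => -(k ^ 2 * P.ouVar s / 2))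
          (-(k ^ 2 * (P.sigmaMu ^ 2 * Real.exp (-2 * P.lam * t)) / 2)) t :=
        (((P.hasDerivAt_ouVar t).const_mul (k ^ 2)).div_const 2).neg
      have h1 := hm_t.cos.mul hS.exp
      set D := Real.exp (-(k ^ 2 * P.ouVar t / 2)) with hD
      have h2 : ∀ y, HasDerivAt (fun y => Real.cos (k * P.ouMean t y + b) * D)
          (-Real.sin (k * P.ouMean t y + b) * (k * E) * D) y := fun y => (hm_η y).cos.mul_const D
      have h3 : deriv (fun y => Real.cos (k * P.ouMean t y + b) * D) =
          fun y => -Real.sin (k * P.ouMean t y + b) * (k * E) * D := funext fun y => (h2 y).deriv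
      have h4 : HasDerivAt (fun y => -Real.sin (k * P.ouMean t y + b) * (k * E) * D)
          (-(Real.cos (k * P.ouMean t η + b) * (k * E)) * (k * E) * D) η :=
        (((hm_η η).sin.neg).mul_const (k * E)).mul_const D
      have hE2 : Real.exp (-2 * P.lam * t) = E ^ 2 := by
        rw [hE, ← Real.exp_nat_mul]
        push_cast
        ring_nf
      simp only [heatOp, generator, iteratedDeriv_succ, iteratedDeriv_zero, ← hD]
      rw [h3, h4.deriv]
      have h5 : deriv (fun s => Real.cos (k * P.ouMean s η + b) *
          Real.exp (-(k ^ 2 * P.ouVar s / 2))) t = _ := h1.deriv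
      rw [h5, hE2]
      ring
    · unfold ouSemigroup
      have h := integral_cos_gaussian (k * P.ouMean r η + b) (k * Real.sqrt (P.ouVar r))
      rw [mul_pow, Real.sq_sqrt (P.ouVar_nonneg hr)] at h
      refine h.symm.trans ?_
      congr 1
      funext z
      congr 1
      ring

theorem hasClassicalFlow_of_mem_trigSpan {f : ℝ → ℝ} (hf : f ∈ trigSpan) :
    P.HasClassicalFlow f := by
  unfold trigSpan at hf
  induction hf using Submodule.span_induction with
  | mem f hf =>
    obtain ⟨⟨k, b⟩, rfl⟩ := hf
    exact P.hasClassicalFlow_cos k b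
  | zero =>
    refine ⟨continuous_const, ⟨0, by simp⟩, fun _ _ => 0, contDiff_const, fun t η => ?_, ?_⟩
    · rw [P.heatOp_fun_fst (fun _ => 0)]
      simp
    · simp [ouSemigroup]
  | add f g _ _ h1 h2 =>
    obtain ⟨hf, ⟨K, hK⟩, W, hW, hW0, hWr⟩ := h1
    obtain ⟨hg, ⟨L, hL⟩, V, hV, hV0, hVr⟩ := h2
    refine ⟨hf.add hg, ⟨K + L, fun η => (abs_add_le _ _).trans (add_le_add (hK η) (hL η))⟩,
      fun t η => W t η + V t η, hW.add hV, fun t η => ?_, fun r hr η => ?_⟩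
    · rw [P.heatOp_add hW hV, hW0, hV0, add_zero]
    · simp only [hWr r hr, hVr r hr, ouSemigroup, Pi.add_apply]
      exact (integral_add (integrable_ouSemigroup hf hK r η) (integrable_ouSemigroup hg hL r η)).symm
  | smul c f _ h1 =>
    obtain ⟨hf, ⟨K, hK⟩, W, hW, hW0, hWr⟩ := h1
    refine ⟨hf.const_smul c, ⟨|c| * K, fun η => ?_⟩, fun t η => c * W t η,
      contDiff_const.mul hW, fun t η => ?_, fun r hr η => ?_⟩
    · simp only [Pi.smul_apply, smul_eq_mul, abs_mul]
      exact mul_le_mul_of_nonneg_left (hK η) (abs_nonneg c)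
    · rw [P.heatOp_const_mul, hW0, mul_zero]
    · simp only [hWr r hr, ouSemigroup, Pi.smul_apply, smul_eq_mul]
      exact (integral_const_mul _ _).symm

end HabitModel

/-! ### Vanishing errors, quadratic tails and semicontinuity of differences. -/

theorem le_of_forall_pos_le_add_mul {a b q : ℝ} (hq : 0 < q) (h : ∀ ε > 0, a ≤ b + ε * q) :
    a ≤ b := by
  refine le_of_forall_pos_le_add fun ε hε => ?_
  have := h (ε / q) (div_pos hε hq)
  rwa [div_mul_cancel₀ _ hq.ne'] at this

theorem exists_radius (M : ℝ) {ε : ℝ} (hε : 0 < ε) :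
    ∃ R, ∀ x : ℝ, R < |x| → M ≤ ε * (1 + x ^ 2) := by
  refine ⟨|M| / ε + 1, fun x hx => ?_⟩
  have h0 : 0 ≤ |M| / ε := by positivity
  have h1 : |M| / ε ≤ x ^ 2 := by
    rw [← sq_abs]
    nlinarith
  rw [div_le_iff₀ hε] at h1
  have := le_abs_self M
  nlinarith

theorem UpperSemicontinuousOn.sub_lowerSemicontinuousOn {X : Type*} [TopologicalSpace X]
    {f g : X → ℝ} {s : Set X} (hf : UpperSemicontinuousOn f s) (hg : LowerSemicontinuousOn g s) :
    UpperSemicontinuousOn (fun x => f x - g x) s := by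
  have hg' : UpperSemicontinuousOn (fun x => -g x) s := fun x hx y hy =>
    (hg x hx (-y) (by linarith)).mono fun z hz => by linarith
  simpa only [sub_eq_add_neg] using hf.add hg'

namespace HabitModel

variable {P : HabitModel}

/-! ### Comparison with classical solutions -/

/-- A maximum over a compact box that contains all points with D > 0 is attained after t₀. It is
local relative to the whole strip because D ≤ 0 at the later points outside the box. The final time
T is allowed, as in the definition of semisolutions. -/
theorem exists_localMax_pos {D : ℝ → ℝ → ℝ} {t₀ : ℝ}
    (hD : UpperSemicontinuousOn (uncurry D) (Icc t₀ P.T ×ˢ univ)) (c R : ℝ)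
    (hR : ∀ t ∈ Icc t₀ P.T, ∀ η, R < |η - c| → D t η ≤ 0) (h0 : ∀ η, D t₀ η ≤ 0)
    {t η : ℝ} (ht : t ∈ Icc t₀ P.T) (hpos : 0 < D t η) :
    ∃ s ∈ Ioc t₀ P.T, ∃ y, 0 < D s y ∧ IsLocalMaxOn (uncurry D) P.strip (s, y) := by
  have hin : ∀ s ∈ Icc t₀ P.T, ∀ y, 0 < D s y → y ∈ Icc (c - R) (c + R) := by
    intro s hs y hy
    have h1 : |y - c| ≤ R := by
      by_contra hcon
      exact (hR s hs y (not_le.1 hcon)).not_gt hy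
    rw [abs_le] at h1
    exact ⟨by linarith, by linarith⟩
  obtain ⟨⟨s, y⟩, ⟨hs, -⟩, hmax⟩ := UpperSemicontinuousOn.exists_isMaxOn
    (s := Icc t₀ P.T ×ˢ Icc (c - R) (c + R)) ⟨(t, η), ht, hin t ht η hpos⟩
    (isCompact_Icc.prod isCompact_Icc) (hD.mono (prod_mono le_rfl (subset_univ _)))
  have hsy : 0 < D s y := hpos.trans_le (hmax (a := (t, η)) ⟨ht, hin t ht η hpos⟩)
  have hs0 : t₀ < s := lt_of_le_of_ne hs.1 fun h => by
    subst h
    exact (h0 y).not_gt hsy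
  refine ⟨s, ⟨hs0, hs.2⟩, y, hsy, ?_⟩
  have hnhds : ∀ᶠ q : ℝ × ℝ in 𝓝[P.strip] (s, y), t₀ < q.1 :=
    (continuous_fst.continuousAt.eventually (lt_mem_nhds hs0)).filter_mono nhdsWithin_le_nhds
  filter_upwards [hnhds, self_mem_nhdsWithin] with q hq hqs
  have hqt : q.1 ∈ Icc t₀ P.T := ⟨hq.le, hqs.1.2⟩
  by_cases hq0 : 0 < D q.1 q.2
  · exact hmax (a := q) ⟨hqt, hin _ hqt _ hq0⟩
  · exact (not_lt.1 hq0).trans hsy.le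

/-- A steep downward paraboloid touches v from below near any point where v < g; v is still below g
at the touching point, against the first entry of the minimum. -/
theorem obstacle_le_supersolution {g v : ℝ → ℝ → ℝ} (hg : ContinuousOn (uncurry g) P.closedStrip)
    (hv : LowerSemicontinuousOn (uncurry v) P.closedStrip) {K : ℝ}
    (hK : ∀ t ∈ Icc 0 P.T, ∀ η, |v t η| ≤ K) (hvs : P.IsViscositySupersolution g v)
    {t : ℝ} (ht : t ∈ Ioc 0 P.T) (η : ℝ) : g t η ≤ v t η := by
  by_contra! hcon
  have htI : t ∈ Icc 0 P.T := ⟨ht.1.le, ht.2⟩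
  have hK0 : 0 ≤ K := (abs_nonneg _).trans (hK t htI η)
  -- Half the gap: v(t,η) + e = g(t,η) - e separates the test function from g nearby.
  set e := (g t η - v t η) / 2 with he
  have he0 : 0 < e := by linarith
  obtain ⟨ρ', hρ', hball⟩ := Metric.continuousOn_iff.1 hg (t, η) ⟨htI, mem_univ _⟩ e he0
  -- With ρ ≤ t, the initial time lies in the far region, where the paraboloid is below v.
  set ρ := min ρ' t with hρdef
  have hρ : 0 < ρ := lt_min hρ' ht.1
  set n := (2 * K + e) / ρ ^ 2 with hn
  have hn0 : 0 ≤ n := by positivity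
  have hnρ : ∀ x : ℝ, ρ ≤ |x| → 2 * K + e ≤ n * x ^ 2 := by
    intro x hx
    have h1 : ρ ^ 2 ≤ x ^ 2 := by
      rw [← sq_abs x]
      gcongr
    calc 2 * K + e = n * ρ ^ 2 := by rw [hn]; field_simp
      _ ≤ n * x ^ 2 := by gcongr
  set φ : ℝ → ℝ → ℝ := fun s y => (v t η + e) - n * ((s - t) ^ 2 + (y - η) ^ 2) with hφ
  have hφ2 : ContDiff ℝ 2 (uncurry φ) := by
    unfold uncurry
    fun_prop
  have hfar : ∀ s ∈ Icc 0 P.T, ∀ y, (ρ ≤ |s - t| ∨ ρ ≤ |y - η|) → φ s y - v s y ≤ 0 := by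
    intro s hs y hsy
    have h1 := abs_le.1 (hK s hs y)
    have h2 := abs_le.1 (hK t htI η)
    have h3 := mul_nonneg hn0 (sq_nonneg (s - t))
    have h4 := mul_nonneg hn0 (sq_nonneg (y - η))
    simp only [hφ]
    rcases hsy with h | h <;> have := hnρ _ h <;> linarith
  obtain ⟨s, hs, y, hpos, hmax⟩ := exists_localMax_pos (P := P) (D := fun s y => φ s y - v s y)
    (t₀ := 0) (hφ2.continuous.continuousOn.upperSemicontinuousOn.sub_lowerSemicontinuousOn hv) η ρ
    (fun s hs y hy => hfar s hs y (Or.inr hy.le))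
    (fun y => hfar 0 ⟨le_rfl, ht.1.le.trans ht.2⟩ y (Or.inl (by
      rw [zero_sub, abs_neg, abs_of_pos ht.1]
      exact min_le_right _ _)))
    htI (η := η) (by simpa [hφ] using he0)
  have hsI : s ∈ Icc 0 P.T := ⟨hs.1.le, hs.2⟩
  have hmin : IsLocalMinOn (fun q : ℝ × ℝ => v q.1 q.2 - φ q.1 q.2) P.strip (s, y) := by
    filter_upwards [hmax] with q hq
    simp only [uncurry] at hq
    linarith
  have h1 := (hvs φ (IsC12.of_contDiff hφ2) s hs y hmin).trans (min_le_left _ _)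
  have hclose : dist (s, y) (t, η) < ρ' := by
    rw [Prod.dist_eq, max_lt_iff, Real.dist_eq, Real.dist_eq]
    refine ⟨?_, ?_⟩ <;> by_contra! h
    · exact (hfar s hsI y (Or.inl ((min_le_left _ _).trans h))).not_gt hpos
    · exact (hfar s hsI y (Or.inr ((min_le_left _ _).trans h))).not_gt hpos
  have h2 := hball (s, y) ⟨hsI, mem_univ _⟩ hclose
  rw [Real.dist_eq, abs_lt] at h2
  have h3 := mul_nonneg hn0 (add_nonneg (sq_nonneg (s - t)) (sq_nonneg (y - η)))
  simp only [hφ, uncurry] at hpos h2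
  linarith

/-- The smooth flow of an approximation of f, lowered by a multiple of `growth`, is a strict
classical subsolution, so it cannot touch v from below after t₀. -/
theorem ouSemigroup_le_supersolution (hl : 0 ≤ P.lam) {g v : ℝ → ℝ → ℝ}
    (hv : LowerSemicontinuousOn (uncurry v) P.closedStrip) {K : ℝ}
    (hK : ∀ t ∈ Icc 0 P.T, ∀ η, |v t η| ≤ K) (hvs : P.IsViscositySupersolution g v)
    {f : ℝ → ℝ} (hf : Continuous f) {L : ℝ} (hL : ∀ η, |f η| ≤ L) {κ : ℝ} (hκ : 0 ≤ κ)
    {t₀ : ℝ} (ht₀ : 0 ≤ t₀) (hfv : ∀ η, f η ≤ v t₀ η + κ * P.growth t₀ η)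
    {r : ℝ} (hr : 0 ≤ r) (hrT : t₀ + r ≤ P.T) (η : ℝ) :
    P.ouSemigroup f r η ≤ v (t₀ + r) η + κ * P.growth (t₀ + r) η := by
  have hgr : 1 ≤ P.growth (t₀ + r) η := P.one_le_growth (add_nonneg ht₀ hr) η
  refine le_of_forall_pos_le_add_mul (q := 3 * P.growth (t₀ + r) η) (by linarith) fun ε hε => ?_
  obtain ⟨f', hf', hnear⟩ := exists_trigSpan_near hf hL P.mubar hε
  obtain ⟨hf'c, ⟨L', hL'⟩, W, hW, hW0, hWr⟩ := P.hasClassicalFlow_of_mem_trigSpan hf'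
  have hWb : ∀ t, t₀ ≤ t → ∀ y, |W (t - t₀) y| ≤ L' := fun t ht y => by
    rw [hWr _ (sub_nonneg.2 ht)]
    exact abs_ouSemigroup_le hL' _ _
  set Ψ : ℝ → ℝ → ℝ := fun t y => W (t - t₀) y + -(κ + 2 * ε) * P.growth t y with hΨ
  have hΨ1 := contDiff_shift hW t₀
  have hΨ2 : ContDiff ℝ 2 (uncurry fun t y => -(κ + 2 * ε) * P.growth t y) :=
    contDiff_const.mul P.contDiff_growth
  have hΨc : ContDiff ℝ 2 (uncurry Ψ) := hΨ1.add hΨ2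
  have hΨop : ∀ t y, P.heatOp Ψ t y < 0 := fun t y => by
    rw [P.heatOp_add hΨ1 hΨ2, P.heatOp_shift W t₀, hW0, P.heatOp_const_mul]
    have := mul_pos (by positivity : 0 < κ + 2 * ε) (P.heatOp_growth hl t y)
    linarith
  have key : Ψ (t₀ + r) η ≤ v (t₀ + r) η := by
    by_contra! hcon
    obtain ⟨R, hR⟩ := exists_radius (L' + K) hε
    obtain ⟨s, hs, y, -, hmax⟩ := exists_localMax_pos (P := P) (D := fun s y => Ψ s y - v s y)
      (t₀ := t₀) (UpperSemicontinuousOn.mono (s := P.closedStrip)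
        (hΨc.continuous.continuousOn.upperSemicontinuousOn.sub_lowerSemicontinuousOn hv)
        (prod_mono (Icc_subset_Icc_left ht₀) le_rfl)) P.mubar R (fun s hs y hy => by
          have h1 := hR _ hy
          have h2 := (abs_le.1 (hWb s hs.1 y)).2
          have h3 := (abs_le.1 (hK s ⟨ht₀.trans hs.1, hs.2⟩ y)).1
          have h4 := P.growth_ge (ht₀.trans hs.1) y
          have h5 := mul_le_mul_of_nonneg_left h4 hε.le
          have h6 : 0 ≤ (κ + ε) * P.growth s y :=
            mul_nonneg (by positivity) ((by positivity : (0 : ℝ) ≤ _).trans h4)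
          simp only [hΨ]
          linarith)
      (fun y => by
        have h1 := (abs_le.1 (hnear y)).1
        have h2 := mul_le_mul_of_nonneg_left (P.growth_ge ht₀ y) hε.le
        have h3 := hfv y
        have h4 : 0 ≤ ε * P.growth t₀ y :=
          mul_nonneg hε.le (zero_le_one.trans (P.one_le_growth ht₀ y))
        simp only [hΨ, sub_self, hWr 0 le_rfl, ouSemigroup_zero]
        linarith)
      (t := t₀ + r) ⟨by linarith, hrT⟩ (η := η) (sub_pos.2 hcon)
    have hmin : IsLocalMinOn (fun q : ℝ × ℝ => v q.1 q.2 - Ψ q.1 q.2) P.strip (s, y) := by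
      filter_upwards [hmax] with q hq
      simp only [uncurry] at hq
      linarith
    have h1 := (hvs Ψ (IsC12.of_contDiff hΨc) s ⟨ht₀.trans_lt hs.1, hs.2⟩ y hmin).trans
      (min_le_right _ _)
    exact (hΨop s y).not_ge h1
  have h1 := ouSemigroup_le_add (P := P) (g := f') hf hf'c hl hε.le hL hL' (fun y => by
    have := (abs_le.1 (hnear y)).2
    linarith) hr η
  simp only [hΨ, add_sub_cancel_left, hWr r hr] at key
  have h2 := mul_le_mul_of_nonneg_left (P.growth_mono (by linarith : r ≤ t₀ + r) η) hε.le
  linarith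

/-- The obstacle estimate is available only on a short window, while a maximum must be local in the
full strip, where the end of the window is no boundary. Hence the estimate is assumed up to 2h and
concluded up to h, with a barrier in time in between. -/
theorem subsolution_le_ouSemigroup (hl : 0 ≤ P.lam) {g u : ℝ → ℝ → ℝ}
    (hu : UpperSemicontinuousOn (uncurry u) P.closedStrip) {K : ℝ}
    (hK : ∀ t ∈ Icc 0 P.T, ∀ η, |u t η| ≤ K) (hus : P.IsViscositySubsolution g u)
    {f : ℝ → ℝ} (hf : Continuous f) {L : ℝ} (hL : ∀ η, |f η| ≤ L) {κ : ℝ} (hκ : 0 ≤ κ)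
    {t₀ h : ℝ} (ht₀ : 0 ≤ t₀) (hh : 0 < h) (huf : ∀ η, u t₀ η ≤ f η + κ * P.growth t₀ η)
    (hobst : ∀ r ∈ Icc 0 (2 * h), t₀ + r ≤ P.T → ∀ η, u (t₀ + r) η ≤ g (t₀ + r) η →
      u (t₀ + r) η ≤ P.ouSemigroup f r η + κ * P.growth (t₀ + r) η)
    {r : ℝ} (hr : r ∈ Icc 0 h) (hrT : t₀ + r ≤ P.T) (η : ℝ) :
    u (t₀ + r) η ≤ P.ouSemigroup f r η + κ * P.growth (t₀ + r) η := by
  have hgr : 1 ≤ P.growth (t₀ + r) η := P.one_le_growth (add_nonneg ht₀ hr.1) η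
  refine le_of_forall_pos_le_add_mul (q := 5 * P.growth (t₀ + r) η) (by linarith) fun ε hε => ?_
  obtain ⟨f', hf', hnear⟩ := exists_trigSpan_near hf hL P.mubar hε
  obtain ⟨hf'c, ⟨L', hL'⟩, W, hW, hW0, hWr⟩ := P.hasClassicalFlow_of_mem_trigSpan hf'
  have hK0 : 0 ≤ K := (abs_nonneg _).trans (hK t₀ ⟨ht₀, by linarith [hr.1]⟩ 0)
  have hL0 : 0 ≤ L' := (abs_nonneg _).trans (hL' 0)
  have hWb : ∀ t, t₀ ≤ t → ∀ y, |W (t - t₀) y| ≤ L' := fun t ht y => by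
    rw [hWr _ (sub_nonneg.2 ht)]
    exact abs_ouSemigroup_le hL' _ _
  -- Makes `E` at most ε up to t₀ + h but at least K + L' from t₀ + 2h on, so no positive maximum
  -- occurs after the window.
  set M := (K + L') / (ε * h) with hM
  have hM0 : 0 ≤ M := by positivity
  set E : ℝ → ℝ := fun t => ε * Real.exp (M * (t - (t₀ + h))) with hE
  have hE0 : ∀ t, 0 ≤ E t := fun t => by positivity
  have hEd : ∀ t, 0 ≤ deriv E t := fun t => by
    have := ((((hasDerivAt_id t).sub_const (t₀ + h)).const_mul M).exp).const_mul ε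
    have h2 : deriv E t = _ := this.deriv
    rw [h2]
    positivity
  have hElarge : ∀ t, t₀ + 2 * h ≤ t → K + L' ≤ E t := fun t ht => by
    have h1 : M * h ≤ M * (t - (t₀ + h)) := mul_le_mul_of_nonneg_left (by linarith) hM0
    have h2 := Real.add_one_le_exp (M * (t - (t₀ + h)))
    have h3 : ε * (M * h) = K + L' := by rw [hM]; field_simp
    have h4 : ε * (M * h) ≤ ε * Real.exp (M * (t - (t₀ + h))) :=
      mul_le_mul_of_nonneg_left (by linarith) hε.le
    linarith
  set Φ : ℝ → ℝ → ℝ := fun t y => (W (t - t₀) y + (κ + 3 * ε) * P.growth t y) + E t with hΦ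
  have hΦ1 := contDiff_shift hW t₀
  have hΦ2 : ContDiff ℝ 2 (uncurry fun t y => (κ + 3 * ε) * P.growth t y) :=
    contDiff_const.mul P.contDiff_growth
  have hΦ3 : ContDiff ℝ 2 (uncurry fun (t : ℝ) (_ : ℝ) => E t) := by
    unfold uncurry
    fun_prop
  have hΦc : ContDiff ℝ 2 (uncurry Φ) := (hΦ1.add hΦ2).add hΦ3
  have hΦop : ∀ t y, 0 < P.heatOp Φ t y := fun t y => by
    rw [P.heatOp_add (φ := fun t y => W (t - t₀) y + (κ + 3 * ε) * P.growth t y) (hΦ1.add hΦ2) hΦ3,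
      P.heatOp_add hΦ1 hΦ2, P.heatOp_shift W t₀, hW0, P.heatOp_const_mul, P.heatOp_fun_fst]
    have := mul_pos (by positivity : 0 < κ + 3 * ε) (P.heatOp_growth hl t y)
    linarith [hEd t]
  have key : u (t₀ + r) η ≤ Φ (t₀ + r) η := by
    by_contra! hcon
    obtain ⟨R, hR⟩ := exists_radius (L' + K) hε
    obtain ⟨s, hs, y, hpos, hmax⟩ := exists_localMax_pos (P := P) (D := fun s y => u s y - Φ s y)
      (t₀ := t₀) (UpperSemicontinuousOn.mono (s := P.closedStrip) (hu.sub_lowerSemicontinuousOn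
        hΦc.continuous.continuousOn.lowerSemicontinuousOn)
        (prod_mono (Icc_subset_Icc_left ht₀) le_rfl)) P.mubar R (fun s hs y hy => by
          have h1 := hR _ hy
          have h2 := (abs_le.1 (hWb s hs.1 y)).1
          have h3 := (abs_le.1 (hK s ⟨ht₀.trans hs.1, hs.2⟩ y)).2
          have h4 := P.growth_ge (ht₀.trans hs.1) y
          have h5 := mul_le_mul_of_nonneg_left h4 hε.le
          have h6 : 0 ≤ (κ + 2 * ε) * P.growth s y :=
            mul_nonneg (by positivity) ((by positivity : (0 : ℝ) ≤ _).trans h4)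
          have h7 := hE0 s
          simp only [hΦ]
          linarith)
      (fun y => by
        have h1 := (abs_le.1 (hnear y)).2
        have h2 := mul_le_mul_of_nonneg_left (P.growth_ge ht₀ y) hε.le
        have h3 := huf y
        have h4 : 0 ≤ ε * P.growth t₀ y :=
          mul_nonneg hε.le (zero_le_one.trans (P.one_le_growth ht₀ y))
        have h7 := hE0 t₀
        simp only [hΦ, sub_self, hWr 0 le_rfl, ouSemigroup_zero]
        linarith)
      (t := t₀ + r) ⟨by linarith [hr.1], hrT⟩ (η := η) (sub_pos.2 hcon)
    have hs0 : 0 ≤ s := ht₀.trans hs.1.le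
    have hg0 : 0 ≤ P.growth s y := zero_le_one.trans (P.one_le_growth hs0 y)
    have hs2 : s ≤ t₀ + 2 * h := by
      by_contra! hcon2
      have h1 := hElarge s hcon2.le
      have h2 := (abs_le.1 (hWb s hs.1.le y)).1
      have h3 := (abs_le.1 (hK s ⟨hs0, hs.2⟩ y)).2
      have h6 : 0 ≤ (κ + 3 * ε) * P.growth s y := mul_nonneg (by positivity) hg0
      simp only [hΦ] at hpos
      linarith
    have h1 := hus Φ (IsC12.of_contDiff hΦc) s ⟨ht₀.trans_lt hs.1, hs.2⟩ y hmax
    -- Either u is below the obstacle, where `hobst` contradicts u > Φ, or Φ violates its own strict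
    -- heat inequality.
    rcases min_le_iff.1 h1 with h2 | h2
    · have h3 := hobst (s - t₀) ⟨by linarith [hs.1], by linarith⟩ (by linarith [hs.2]) y
        (by rw [add_sub_cancel]; linarith)
      rw [add_sub_cancel] at h3
      have h4 := ouSemigroup_le_add (P := P) (g := f') hf hf'c hl hε.le hL hL' (fun y => by
        have := (abs_le.1 (hnear y)).2
        linarith) (sub_nonneg.2 hs.1.le) y
      rw [← hWr _ (sub_nonneg.2 hs.1.le)] at h4
      have h5 := mul_le_mul_of_nonneg_left (P.growth_mono (by linarith : s - t₀ ≤ s) y) hε.le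
      have h6 := mul_nonneg hε.le hg0
      have h7 := hE0 s
      simp only [hΦ] at hpos
      linarith
    · exact (hΦop s y).not_ge h2
  have h1 := ouSemigroup_le_add (P := P) (g := f) hf'c hf hl hε.le hL' hL (fun y => by
    have := (abs_le.1 (hnear y)).1
    linarith) hr.1 η
  have h3 : E (t₀ + r) ≤ ε * P.growth (t₀ + r) η := by
    refine mul_le_mul_of_nonneg_left (le_trans ?_ hgr) hε.le
    exact Real.exp_le_one_iff.2 (mul_nonpos_of_nonneg_of_nonpos hM0 (by linarith [hr.2]))
  simp only [hΦ, add_sub_cancel_left, hWr r hr.1] at key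
  have h2 := mul_le_mul_of_nonneg_left (P.growth_mono (by linarith : r ≤ t₀ + r) η) hε.le
  linarith

end HabitModel

/-- Strict insertion of a bounded continuous function between an upper and a
lower semicontinuous function. -/
theorem exists_continuous_between {a b : ℝ → ℝ} (ha : UpperSemicontinuous a)
    (hb : LowerSemicontinuous b) (hab : ∀ x, a x < b x) {K : ℝ} (haK : ∀ x, a x ≤ K)
    (hbK : ∀ x, -K ≤ b x) (hK : 0 ≤ K) :
    ∃ f : ℝ → ℝ, Continuous f ∧ (∀ x, |f x| ≤ K) ∧ (∀ x, a x ≤ f x) ∧ ∀ x, f x ≤ b x := by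
  obtain ⟨f, hf⟩ := exists_continuous_forall_mem_convex_of_local_const
    (t := fun x => Ioo (a x) (b x)) (fun x => convex_Ioo _ _) (fun x => by
      obtain ⟨c, hc1, hc2⟩ := exists_between (hab x)
      exact ⟨c, (ha x c hc1).and (hb x c hc2)⟩)
  refine ⟨fun x => max (-K) (min K (f x)), by fun_prop, fun x => ?_, fun x => ?_, fun x => ?_⟩
  · exact abs_le.2 ⟨le_max_left _ _, max_le (by linarith) (min_le_left _ _)⟩
  · exact le_max_of_le_right (le_min (haK x) (hf x).1.le)
  · exact max_le (hbK x) (min_le_of_right_le (hf x).2.le)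

namespace HabitModel

variable {P : HabitModel}

/-! ### The comparison principle -/

theorem upperSemicontinuous_slice {u : ℝ → ℝ → ℝ}
    (hu : UpperSemicontinuousOn (uncurry u) P.closedStrip) {t : ℝ} (ht : t ∈ Icc 0 P.T) :
    UpperSemicontinuous (u t) := by
  intro η c hc
  have h1 : Tendsto (fun y : ℝ => (t, y)) (𝓝 η) (𝓝[P.closedStrip] (t, η)) :=
    tendsto_nhdsWithin_iff.2 ⟨(by fun_prop : Continuous fun y : ℝ => (t, y)).tendsto η,
      Eventually.of_forall fun y => ⟨ht, mem_univ _⟩⟩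
  exact h1.eventually (hu (t, η) ⟨ht, mem_univ _⟩ c hc)

theorem lowerSemicontinuous_slice {v : ℝ → ℝ → ℝ}
    (hv : LowerSemicontinuousOn (uncurry v) P.closedStrip) {t : ℝ} (ht : t ∈ Icc 0 P.T) :
    LowerSemicontinuous (v t) := by
  intro η c hc
  have h1 : Tendsto (fun y : ℝ => (t, y)) (𝓝 η) (𝓝[P.closedStrip] (t, η)) :=
    tendsto_nhdsWithin_iff.2 ⟨(by fun_prop : Continuous fun y : ℝ => (t, y)).tendsto η,
      Eventually.of_forall fun y => ⟨ht, mem_univ _⟩⟩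
  exact h1.eventually (hv (t, η) ⟨ht, mem_univ _⟩ c hc)

/-- Semicontinuity and compactness give uniformity on bounded η; for large η the weight exceeds M.
-/
theorem eventually_le_of_usc {D : ℝ → ℝ → ℝ} (hT : 0 ≤ P.T)
    (hD : UpperSemicontinuousOn (uncurry D) P.closedStrip) {M : ℝ}
    (hM : ∀ t ∈ Icc 0 P.T, ∀ η, D t η ≤ M) (h0 : ∀ η, D 0 η ≤ 0) {κ : ℝ} (hκ : 0 < κ) :
    ∀ᶠ t in 𝓝 (0 : ℝ), t ∈ Icc 0 P.T → ∀ η, D t η ≤ κ * (1 + (η - P.mubar) ^ 2) := by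
  obtain ⟨R, hR⟩ := exists_radius M hκ
  have h := (isCompact_Icc (a := P.mubar - R) (b := P.mubar + R)).eventually_forall_of_forall_eventually
    (x₀ := (0 : ℝ)) (P := fun t η => (t, η) ∈ P.closedStrip → D t η < κ) fun η _ =>
      eventually_nhdsWithin_iff.1
        (hD (0, η) ⟨⟨le_rfl, hT⟩, mem_univ _⟩ κ ((h0 η).trans_lt hκ))
  filter_upwards [h] with t ht htI η
  by_cases hη : R < |η - P.mubar|
  · exact (hM t htI η).trans (hR _ hη)
  · have h1 := abs_le.1 (not_lt.1 hη)
    have h2 := ht η ⟨by linarith, by linarith⟩ ⟨htI, mem_univ _⟩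
    nlinarith [mul_nonneg hκ.le (sq_nonneg (η - P.mubar))]

/-- The two sides agree at r = 0 up to the positive weight. Joint continuity and compactness make
the step uniform; the weight handles the tails. -/
theorem exists_uniform_step (P : HabitModel) {G : ℝ → ℝ → ℝ} (hG : Continuous (uncurry G)) {K : ℝ}
    (hK : ∀ t η, |G t η| ≤ K) {κ : ℝ} (hκ : 0 < κ) :
    ∃ h > 0, ∀ r ∈ Icc 0 h, ∀ t ∈ Icc 0 P.T, ∀ η,
      G (t + r) η ≤ P.ouSemigroup (G t) r η + κ * (1 + (η - P.mubar) ^ 2) := by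
  obtain ⟨R, hR⟩ := exists_radius (2 * K) hκ
  have hcont : Continuous fun z : ℝ × ℝ × ℝ =>
      G (z.2.1 + z.1) z.2.2 - P.ouSemigroup (G z.2.1) z.1 z.2.2 := by
    have h1 := P.continuous_ouSemigroup hG hK
    exact (hG.comp (by fun_prop : Continuous fun z : ℝ × ℝ × ℝ => (z.2.1 + z.1, z.2.2))).sub
      (h1.comp (by fun_prop : Continuous fun z : ℝ × ℝ × ℝ => (z.2.1, z.1, z.2.2)))
  have h := ((isCompact_Icc (a := (0 : ℝ)) (b := P.T)).prod
      (isCompact_Icc (a := P.mubar - R) (b := P.mubar + R))).eventually_forall_of_forall_eventually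
    (x₀ := (0 : ℝ)) (P := fun r q => G (q.1 + r) q.2 - P.ouSemigroup (G q.1) r q.2 < κ)
    fun q _ => hcont.continuousAt.eventually (gt_mem_nhds (by simpa [ouSemigroup_zero] using hκ))
  obtain ⟨h, hh, hball⟩ := Metric.eventually_nhds_iff.1 h
  refine ⟨h / 2, by positivity, fun r hr t ht η => ?_⟩
  by_cases hη : R < |η - P.mubar|
  · have h1 := hR _ hη
    have h2 := abs_le.1 (hK (t + r) η)
    have h3 := abs_le.1 (abs_ouSemigroup_le (P := P) (hK t) r η)
    linarith
  · have h1 := abs_le.1 (not_lt.1 hη)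
    have h2 := hball (y := r) (by rw [Real.dist_eq, sub_zero, abs_of_nonneg hr.1]; linarith [hr.2])
      (t, η) ⟨ht, by linarith, by linarith⟩
    simp only at h2
    nlinarith [mul_nonneg hκ.le (sq_nonneg (η - P.mubar))]

theorem comparisonPrinciple_of_continuousOn (hT : 0 < P.T) (hl : 0 ≤ P.lam) {g : ℝ → ℝ → ℝ}
    (hg : ContinuousOn (uncurry g) P.closedStrip) : P.ComparisonPrinciple g := by
  rintro u v hu hv ⟨Ku, hKu⟩ ⟨Kv, hKv⟩ hus hvs h0 t ht η
  obtain ⟨K, hKu', hKv'⟩ : ∃ K, (∀ t ∈ Icc 0 P.T, ∀ η, |u t η| ≤ K) ∧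
      ∀ t ∈ Icc 0 P.T, ∀ η, |v t η| ≤ K :=
    ⟨max Ku Kv, fun t ht η => (hKu t ht η).trans (le_max_left _ _),
      fun t ht η => (hKv t ht η).trans (le_max_right _ _)⟩
  have htI : t ∈ Icc 0 P.T := ⟨ht.1.le, ht.2⟩
  have hK0 : 0 ≤ K := (abs_nonneg _).trans (hKu' t htI η)
  -- The obstacle may be unbounded and is continuous only on the strip, so it is truncated and
  -- frozen outside [0,T]. As |u|, |v| ≤ K, the relations u ≤ g and g ≤ v survive.
  set G : ℝ → ℝ → ℝ := fun s y => max (-K) (min K (g (projIcc 0 P.T hT.le s) y)) with hGdef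
  have hGc : Continuous (uncurry G) := by
    have h1 : Continuous fun q : ℝ × ℝ => g (projIcc 0 P.T hT.le q.1) q.2 :=
      hg.comp_continuous (f := fun q : ℝ × ℝ => ((projIcc 0 P.T hT.le q.1 : ℝ), q.2))
        ((continuous_subtype_val.comp (continuous_projIcc.comp continuous_fst)).prodMk
          continuous_snd)
        fun q => ⟨(projIcc 0 P.T hT.le q.1).2, mem_univ _⟩
    exact continuous_const.max (continuous_const.min h1)
  have hGK : ∀ s y, |G s y| ≤ K := fun s y =>
    abs_le.2 ⟨le_max_left _ _, max_le (by linarith) (min_le_left _ _)⟩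
  have hGg : ∀ s ∈ Icc 0 P.T, ∀ y, G s y = max (-K) (min K (g s y)) := fun s hs y => by
    simp only [hGdef, projIcc_of_mem hT.le hs]
  have huG : ∀ s ∈ Icc 0 P.T, ∀ y, u s y ≤ g s y → u s y ≤ G s y := fun s hs y h => by
    rw [hGg s hs]
    exact le_max_of_le_right (le_min (abs_le.1 (hKu' s hs y)).2 h)
  have hGv : ∀ s ∈ Ioc 0 P.T, ∀ y, G s y ≤ v s y := fun s hs y => by
    have hsI : s ∈ Icc 0 P.T := ⟨hs.1.le, hs.2⟩
    rw [hGg s hsI]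
    exact max_le (abs_le.1 (hKv' s hsI y)).1
      (min_le_of_right_le (obstacle_le_supersolution hg hv hKv' hvs hs y))
  have hgrow : 1 ≤ P.growth t η := P.one_le_growth ht.1.le η
  refine le_of_forall_pos_le_add_mul (q := 2 * P.growth t η) (by linarith) fun κ hκ => ?_
  obtain ⟨h₀, hh₀, hstep⟩ := P.exists_uniform_step hGc hGK hκ
  -- a starting time close to `0`
  have hev := eventually_le_of_usc (P := P) (D := fun s y => u s y - v s y) hT.le
    (hu.sub_lowerSemicontinuousOn hv) (M := 2 * K) (fun s hs y => by
      have h1 := abs_le.1 (hKu' s hs y)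
      have h2 := abs_le.1 (hKv' s hs y)
      linarith) (fun y => sub_nonpos.2 (h0 y)) hκ
  obtain ⟨ρ, hρ, hball⟩ := Metric.eventually_nhds_iff.1 hev
  -- Strict positivity matters: v is known to dominate the obstacle only on (0,T].
  obtain ⟨t₀, ht₀, ht₀ρ⟩ := exists_between (lt_min hρ ht.1)
  have ht₀t : t₀ < t := ht₀ρ.trans_le (min_le_right _ _)
  have ht₀I : t₀ ∈ Icc 0 P.T := ⟨ht₀.le, (ht₀t.le.trans ht.2)⟩
  have hstart : ∀ y, u t₀ y - v t₀ y ≤ κ * (1 + (y - P.mubar) ^ 2) := hball (by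
    rw [Real.dist_eq, sub_zero, abs_of_pos ht₀]
    exact ht₀ρ.trans_le (min_le_left _ _)) ht₀I
  -- the step of the scheme
  obtain ⟨n, hn⟩ := exists_nat_gt (2 * (t - t₀) / h₀)
  have hn0 : (0 : ℝ) < n := lt_of_le_of_lt (by have := sub_pos.2 ht₀t; positivity) hn
  set h := (t - t₀) / n with hh
  have hhpos : 0 < h := div_pos (sub_pos.2 ht₀t) hn0
  have hnh : n * h = t - t₀ := by rw [hh]; field_simp
  -- The obstacle estimate is needed over two steps, because of the time barrier.
  have h2h : 2 * h ≤ h₀ := by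
    rw [div_lt_iff₀ hh₀] at hn
    by_contra! hcon
    nlinarith
  -- The same κ serves for every k. The invariant G ≤ f is what restores the obstacle estimate at
  -- the next step.
  have scheme : ∀ k : ℕ, k ≤ n → ∃ f : ℝ → ℝ, Continuous f ∧ (∀ y, |f y| ≤ K) ∧
      (∀ y, G (t₀ + k * h) y ≤ f y) ∧
      (∀ y, u (t₀ + k * h) y ≤ f y + κ * P.growth (t₀ + k * h) y) ∧
      ∀ y, f y ≤ v (t₀ + k * h) y + κ * P.growth (t₀ + k * h) y := by
    intro k
    induction k with
    | zero =>
      intro _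
      simp only [Nat.cast_zero, zero_mul, add_zero]
      have hκg : ∀ y, 0 < κ * P.growth t₀ y := fun y =>
        mul_pos hκ (zero_lt_one.trans_le (P.one_le_growth ht₀.le y))
      have hgc : Continuous (P.growth t₀) := (contDiff_slice_snd P.contDiff_growth t₀).continuous
      -- Allowing κ `growth` on both sides makes the inequality between the two envelopes strict.
      obtain ⟨f, hf, hfK, hfa, hfb⟩ := exists_continuous_between
        (a := fun y => max (u t₀ y - κ * P.growth t₀ y) (G t₀ y))
        (b := fun y => v t₀ y + κ * P.growth t₀ y)
        (by
          have h1 : UpperSemicontinuous fun y => u t₀ y + -(κ * P.growth t₀ y) :=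
            (upperSemicontinuous_slice hu ht₀I).add
              (by fun_prop : Continuous fun y => -(κ * P.growth t₀ y)).upperSemicontinuous
          have h2 : UpperSemicontinuous (G t₀) :=
            (hGc.comp (by fun_prop : Continuous fun y : ℝ => (t₀, y))).upperSemicontinuous
          simpa only [← sub_eq_add_neg] using h1.sup h2)
        ((lowerSemicontinuous_slice hv ht₀I).add
          (by fun_prop : Continuous fun y => κ * P.growth t₀ y).lowerSemicontinuous)
        (fun y => by
          have h1 := hstart y
          have h2 := mul_le_mul_of_nonneg_left (P.growth_ge ht₀.le y) hκ.le
          have h3 := hGv t₀ ⟨ht₀, ht₀I.2⟩ y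
          have h4 := hκg y
          exact max_lt (by linarith) (by linarith))
        (K := K) (fun y => by
          have h1 := abs_le.1 (hKu' t₀ ht₀I y)
          exact max_le (by linarith [hκg y]) (abs_le.1 (hGK t₀ y)).2)
        (fun y => by
          have h1 := abs_le.1 (hKv' t₀ ht₀I y)
          linarith [hκg y]) hK0
      refine ⟨f, hf, hfK, fun y => (le_max_right _ _).trans (hfa y), fun y => ?_, hfb⟩
      have := (le_max_left _ _).trans (hfa y)
      linarith
    | succ k ih =>
      intro hk
      obtain ⟨f, hf, hfK, hfG, hfu, hfv⟩ := ih (by omega)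
      have hk0 : 0 ≤ k * h := by positivity
      have hs0 : 0 < t₀ + k * h := by linarith
      have hkn : t₀ + k * h + h ≤ t := by
        have h1 : ((k + 1 : ℕ) : ℝ) * h ≤ n * h :=
          mul_le_mul_of_nonneg_right (by exact_mod_cast hk) hhpos.le
        push_cast at h1
        linarith
      have hkT : t₀ + k * h + h ≤ P.T := hkn.trans ht.2
      have hsI : t₀ + k * h ∈ Icc 0 P.T := ⟨hs0.le, by linarith⟩
      have hs'I : t₀ + k * h + h ∈ Icc 0 P.T := ⟨by linarith, hkT⟩
      have hcast : t₀ + ((k + 1 : ℕ) : ℝ) * h = t₀ + k * h + h := by push_cast; ring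
      rw [hcast]
      have hPc : Continuous (P.ouSemigroup f h) :=
        (P.continuous_ouSemigroup (F := fun _ => f) (hf.comp continuous_snd) fun _ => hfK).comp
          (by fun_prop : Continuous fun y : ℝ => ((0 : ℝ), h, y))
      have hPK := abs_ouSemigroup_le (P := P) hfK h
      have hmax : Continuous fun y => max (P.ouSemigroup f h y) (G (t₀ + k * h + h) y) :=
        hPc.max (hGc.comp (by fun_prop : Continuous fun y : ℝ => (t₀ + k * h + h, y)))
      refine ⟨_, hmax, fun y => ?_, fun y => le_max_right _ _, fun y => ?_, fun y => ?_⟩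
      · have h1 := abs_le.1 (hPK y)
        exact abs_le.2 ⟨le_max_of_le_left h1.1, max_le h1.2 (abs_le.1 (hGK _ y)).2⟩
      -- Where u is below the obstacle: u ≤ G(s+r) ≤ P_r G(s) + κ(1 + (η - μbar)²) ≤ P_r f + κ
      -- `growth`, with s the current time.
      · have h1 := subsolution_le_ouSemigroup hl hu hKu' hus hf hfK hκ.le hs0.le hhpos hfu
          (fun r hr hrT y hug => by
            have hrI : t₀ + k * h + r ∈ Icc 0 P.T := ⟨by linarith [hr.1], hrT⟩
            have h1 := huG _ hrI y hug
            have h2 := hstep r ⟨hr.1, hr.2.trans h2h⟩ _ hsI y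
            have h3 := ouSemigroup_mono (P := P)
              (hGc.comp (by fun_prop : Continuous fun y : ℝ => (t₀ + k * h, y))) hf
              (hGK (t₀ + k * h)) hfK hfG r y
            have h4 := mul_le_mul_of_nonneg_left (P.growth_ge hrI.1 y) hκ.le
            have h5 : P.ouSemigroup (uncurry G ∘ fun y : ℝ => (t₀ + k * h, y)) r y =
              P.ouSemigroup (G (t₀ + k * h)) r y := rfl
            linarith) ⟨hhpos.le, le_rfl⟩ hkT y
        exact h1.trans (by gcongr; exact le_max_left _ _)
      · refine max_le (ouSemigroup_le_supersolution hl hv hKv' hvs hf hfK hκ.le hs0.le hfv hhpos.le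
          hkT y) ((hGv _ ⟨by linarith, hkT⟩ y).trans ?_)
        have := P.one_le_growth hs'I.1 y
        exact le_add_of_nonneg_right (by positivity)
  obtain ⟨f, -, -, -, hfu, hfv⟩ := scheme n le_rfl
  have hend : t₀ + n * h = t := by rw [hnh]; ring
  rw [hend] at hfu hfv
  linarith [hfu η, hfv η]

end HabitModel

/-! ### Continuity of the obstacle -/

/-- Dominated convergence in the parameter and the limit of integration together. Extending ω by
zero puts the endpoints of [0,T] inside a larger interval. -/
theorem continuousOn_weighted_primitive {T : ℝ} {ω : ℝ → ℝ} (hω : IntegrableOn ω (Icc 0 T))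
    {e : ℝ → ℝ → ℝ} (he : Continuous (uncurry e)) :
    ContinuousOn (fun q : ℝ × ℝ => ∫ s in q.1..T, ω s * e (s - q.1) q.2) (Icc 0 T ×ˢ univ) := by
  have hω' : Integrable ((Icc 0 T).indicator ω) := hω.integrable_indicator measurableSet_Icc
  set F : ℝ × ℝ → ℝ → ℝ := fun q s => (Icc 0 T).indicator ω s * e (s - q.1) q.2 with hF
  have hmain : ∀ q ∈ Icc 0 T ×ˢ (univ : Set ℝ),
      ContinuousAt (fun q : ℝ × ℝ => -∫ s in T..q.1, F q s) q := by
    intro q hq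
    have hT : 0 ≤ T := hq.1.1.trans hq.1.2
    have hc : Continuous fun z : (ℝ × ℝ) × ℝ => e (z.2 - z.1.1) z.1.2 :=
      he.comp (by fun_prop : Continuous fun z : (ℝ × ℝ) × ℝ => (z.2 - z.1.1, z.1.2))
    obtain ⟨C, hC⟩ := ((isCompact_closedBall q 1).prod
      (isCompact_Icc (a := (-1 : ℝ)) (b := T + 1))).exists_bound_of_continuousOn hc.continuousOn
    have hpar := intervalIntegral.continuousAt_parametric_primitive_of_dominated (μ := volume)
      (F := F) (fun s => ‖(Icc 0 T).indicator ω s‖ * C) (-1) (T + 1) (a₀ := T) (b₀ := q.1) (x₀ := q)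
      (fun x => (hω'.aestronglyMeasurable.mul (Continuous.aestronglyMeasurable
        (hc.comp (by fun_prop : Continuous fun s : ℝ => (x, s))))).restrict)
      (by
        filter_upwards [Metric.closedBall_mem_nhds q one_pos] with x hx
        refine (ae_restrict_iff' measurableSet_uIoc).2 (ae_of_all _ fun s hs => ?_)
        rw [uIoc_of_le (by linarith)] at hs
        simp only [hF, norm_mul]
        exact mul_le_mul_of_nonneg_left (hC (x, s) ⟨hx, hs.1.le, hs.2⟩) (norm_nonneg _))
      (hω'.norm.mul_const C).intervalIntegrable
      (ae_of_all _ fun s => Continuous.continuousAt (continuous_const.mul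
        (hc.comp (by fun_prop : Continuous fun x : ℝ × ℝ => (x, s)))))
      ⟨by linarith, by linarith⟩ ⟨by linarith [hq.1.1], by linarith [hq.1.2]⟩ (by simp)
    exact (ContinuousAt.comp (f := fun q : ℝ × ℝ => (q, q.1)) (x := q) hpar
      (by fun_prop : Continuous fun q : ℝ × ℝ => (q, q.1)).continuousAt).neg
  refine ContinuousOn.congr (fun q hq => (hmain q hq).continuousWithinAt) fun q hq => ?_
  rw [← intervalIntegral.integral_symm]
  refine intervalIntegral.integral_congr fun s hs => ?_
  rw [uIcc_of_le hq.1.2] at hs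
  simp only [hF, indicator_of_mem (show s ∈ Icc 0 T from ⟨hq.1.1.trans hs.1, hs.2⟩)]

/-- The denominator is known to be positive only for h ≥ 0; clamping the argument gives a globally
continuous function. -/
theorem continuous_riccatiSol_max {γ₁ γ₂ γ₃ : ℝ} (hγ : γ₁ * γ₃ ≤ 0) :
    Continuous fun h => riccatiSol γ₁ γ₂ γ₃ (max h 0) :=
  continuous_iff_continuousAt.2 fun h => ContinuousAt.comp (f := fun h : ℝ => max h 0) (x := h)
    (hasDerivAt_riccatiSol hγ (le_max_right h 0)).continuousAt (by fun_prop)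

theorem continuous_riccatiLin_max {γ₁ γ₂ γ₃ c : ℝ} (hγ : γ₁ * γ₃ ≤ 0) :
    Continuous fun h => riccatiLin γ₁ γ₂ γ₃ c (max h 0) :=
  continuous_iff_continuousAt.2 fun h => ContinuousAt.comp (f := fun h : ℝ => max h 0) (x := h)
    (hasDerivAt_riccatiLin hγ (le_max_right h 0)).continuousAt (by fun_prop)

theorem integral_comp_sub_left_max (f : ℝ → ℝ) {t s : ℝ} (hts : t ≤ s) :
    ∫ r in t..s, f (s - r) = ∫ h in (0 : ℝ)..(s - t), f (max h 0) := by
  rw [intervalIntegral.integral_comp_sub_left, sub_self]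
  refine intervalIntegral.integral_congr fun h hh => ?_
  rw [uIcc_of_le (sub_nonneg.2 hts)] at hh
  simp only [max_eq_left hh.1]

namespace HabitModel

variable {P : HabitModel}

/-- Negative p gives γ₁ ≥ 0 ≥ γ₃, which rules out blow-up of the Riccati solution. -/
theorem Admissible.gamma1_mul_gamma3 (hP : P.Admissible) : P.gamma1 * P.gamma3 ≤ 0 := by
  have hp := hP.p_neg
  have h1 : P.rho ^ 2 ≤ 1 := by
    have := hP.rho_mem
    nlinarith [this.1, this.2]
  have h2 : 0 ≤ 1 - P.p + P.p * P.rho ^ 2 := by nlinarith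
  have h3 : 0 < 1 - P.p := by linarith
  have h4 : 0 ≤ P.gamma1 := by
    unfold gamma1
    positivity
  have h5 : P.gamma3 ≤ 0 := by
    unfold gamma3
    have := hP.sigmaS_pos
    exact div_nonpos_of_nonpos_of_nonneg hp.le (by positivity)
  exact mul_nonpos_of_nonneg_of_nonpos h4 h5

/-- The coefficient equations are autonomous, so the exponent depends on t and s only through s - t.
-/
theorem Admissible.exists_exponent (hP : P.Admissible) :
    ∃ e : ℝ → ℝ → ℝ, Continuous (uncurry e) ∧ ∀ t s η, t ≤ s →
      Real.exp (P.A t s * η ^ 2 + P.B t s * η + P.C t s) = e (s - t) η := by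
  have hγ := hP.gamma1_mul_gamma3
  have hγw : (1 - P.rho ^ 2) * P.sigmaMu ^ 2 * (-(1 / P.sigmaS ^ 2)) ≤ 0 := by
    have h1 : 0 ≤ 1 - P.rho ^ 2 := by
      have := hP.rho_mem
      nlinarith [this.1, this.2]
    have h2 := hP.sigmaS_pos
    exact mul_nonpos_of_nonneg_of_nonpos (by positivity) (neg_nonpos.2 (by positivity))
  set α : ℝ → ℝ := riccatiSol P.gamma1 P.gamma2 P.gamma3 with hα
  set β : ℝ → ℝ := riccatiLin P.gamma1 P.gamma2 P.gamma3 (P.lam * P.mubar) with hβ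
  set ω : ℝ → ℝ := riccatiSol ((1 - P.rho ^ 2) * P.sigmaMu ^ 2)
    (-((P.lam * P.sigmaS + P.rho * P.sigmaMu) / P.sigmaS)) (-(1 / P.sigmaS ^ 2)) with hω
  have hαc : Continuous fun h => α (max h 0) := continuous_riccatiSol_max hγ
  have hβc : Continuous fun h => β (max h 0) := continuous_riccatiLin_max hγ
  have hωc : Continuous fun h => ω (max h 0) := continuous_riccatiSol_max hγw
  set Fl : ℝ → ℝ := fun h =>
    P.sigmaMu ^ 2 * α h + P.gamma1 / 2 * β h ^ 2 + P.lam * P.mubar * β h with hFl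
  set Fg : ℝ → ℝ := fun h => P.sigmaMu ^ 2 * (1 - P.rho ^ 2) * (ω h - α h) with hFg
  have hFlc : Continuous fun h => Fl (max h 0) :=
    ((hαc.const_mul _).add ((hβc.pow 2).const_mul _)).add (hβc.const_mul _)
  have hFgc : Continuous fun h => Fg (max h 0) := (hωc.sub hαc).const_mul _
  have hil : Continuous fun h => ∫ u in (0 : ℝ)..h, Fl (max u 0) :=
    intervalIntegral.continuous_primitive (fun a b => hFlc.intervalIntegrable a b) 0
  have hig : Continuous fun h => ∫ u in (0 : ℝ)..h, Fg (max u 0) :=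
    intervalIntegral.continuous_primitive (fun a b => hFgc.intervalIntegrable a b) 0
  refine ⟨fun h η => Real.exp (α (max h 0) / (1 - P.p) * η ^ 2 + β (max h 0) / (1 - P.p) * η +
    ((∫ u in (0 : ℝ)..h, Fl (max u 0)) - P.p * -∫ u in (0 : ℝ)..h, Fg (max u 0)) / (1 - P.p)),
    ?_, fun t s η hts => ?_⟩
  · have h1 := hαc.comp (continuous_fst (X := ℝ) (Y := ℝ))
    have h2 := hβc.comp (continuous_fst (X := ℝ) (Y := ℝ))
    have h3 := hil.comp (continuous_fst (X := ℝ) (Y := ℝ))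
    have h4 := hig.comp (continuous_fst (X := ℝ) (Y := ℝ))
    exact Real.continuous_exp.comp ((((h1.div_const _).mul (continuous_snd.pow 2)).add
      ((h2.div_const _).mul continuous_snd)).add ((h3.sub (h4.neg.const_mul _)).div_const _))
  · have h1 : P.l t s = ∫ u in (0 : ℝ)..(s - t), Fl (max u 0) :=
      integral_comp_sub_left_max Fl hts
    have h2 : P.g t s = -∫ u in (0 : ℝ)..(s - t), Fg (max u 0) :=
      congrArg Neg.neg (integral_comp_sub_left_max Fg hts)
    simp only [A, B, C, h1, h2, max_eq_left (sub_nonneg.2 hts)]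
    rfl

/-- With Φ a primitive of δ - α, m(t) factors as exp(-Φ(t)) ∫_t^T exp(Φ(s)) ds. -/
theorem Admissible.continuousOn_m (hP : P.Admissible) : ContinuousOn P.m (Icc 0 P.T) := by
  have hT := hP.T_pos.le
  have hint : IntervalIntegrable (fun v => P.delta v - P.alpha v) volume 0 P.T :=
    hP.delta_int.sub hP.alpha_int
  set Φ : ℝ → ℝ := fun t => ∫ v in (0 : ℝ)..t, (P.delta v - P.alpha v) with hΦ
  have hΦc : ContinuousOn Φ (Icc 0 P.T) := by
    have := intervalIntegral.continuousOn_primitive_interval' hint left_mem_uIcc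
    rwa [uIcc_of_le hT] at this
  have hsub : ∀ t ∈ Icc 0 P.T, IntervalIntegrable (fun v => P.delta v - P.alpha v) volume 0 t :=
    fun t ht => hint.mono_set (by
      rw [uIcc_of_le hT, uIcc_of_le ht.1]
      exact Icc_subset_Icc_right ht.2)
  have hexp : ContinuousOn (fun s => Real.exp (Φ s)) (Icc 0 P.T) :=
    Real.continuous_exp.comp_continuousOn hΦc
  have hprim : ContinuousOn (fun t => ∫ s in t..P.T, Real.exp (Φ s)) (Icc 0 P.T) := by
    have := intervalIntegral.continuousOn_primitive_interval_left (a := 0) (b := P.T)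
      (f := fun s => Real.exp (Φ s)) (μ := volume) (by
        rw [uIcc_of_le hT]
        exact hexp.integrableOn_Icc)
    rwa [uIcc_of_le hT] at this
  refine ContinuousOn.congr ((Real.continuous_exp.comp_continuousOn hΦc.neg).mul hprim)
    fun t ht => ?_
  change _ = Real.exp (-Φ t) * ∫ s in t..P.T, Real.exp (Φ s)
  simp only [m]
  rw [← intervalIntegral.integral_const_mul]
  refine intervalIntegral.integral_congr fun s hs => ?_
  rw [uIcc_of_le ht.2] at hs
  have h1 := intervalIntegral.integral_interval_sub_left (hsub s ⟨ht.1.trans hs.1, hs.2⟩) (hsub t ht)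
  simp only [← h1, ← Real.exp_add]
  congr 1
  simp only [hΦ]
  ring

theorem m_nonneg {t : ℝ} (ht : t ≤ P.T) : 0 ≤ P.m t :=
  intervalIntegral.integral_nonneg ht fun _ _ => (Real.exp_pos _).le

/-- Since p < 0, the exponent p/(p-1) is below 1, so the weight is dominated by 1 + δm, with m
continuous and δ integrable. -/
theorem Admissible.integrableOn_weight (hP : P.Admissible) :
    IntegrableOn (fun s => (1 + P.delta s * P.m s) ^ (P.p / (P.p - 1))) (Icc 0 P.T) := by
  have hδ : IntegrableOn P.delta (Icc 0 P.T) := by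
    have := hP.delta_int
    rwa [intervalIntegrable_iff_integrableOn_Icc_of_le hP.T_pos.le] at this
  have hδm : IntegrableOn (fun s => 1 + P.delta s * P.m s) (Icc 0 P.T) :=
    (integrableOn_const (by simp)).add (hδ.mul_continuousOn hP.continuousOn_m isCompact_Icc)
  have hp := hP.p_neg
  refine Integrable.mono' hδm (hδm.aestronglyMeasurable.aemeasurable.pow_const _).aestronglyMeasurable
    ((ae_restrict_iff' measurableSet_Icc).2 (ae_of_all _ fun s hs => ?_))
  have h1 : 1 ≤ 1 + P.delta s * P.m s :=
    le_add_of_nonneg_right (mul_nonneg (hP.delta_nonneg s hs) (m_nonneg hs.2))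
  rw [Real.norm_of_nonneg (Real.rpow_nonneg (zero_le_one.trans h1) _)]
  refine (Real.rpow_le_rpow_of_exponent_le h1 (y := P.p / (P.p - 1)) (z := 1) ?_).trans
    (Real.rpow_one _).le
  rw [div_le_one_of_neg (by linarith)]
  linarith

theorem Admissible.continuousOn_revObstacle (hP : P.Admissible) :
    ContinuousOn (uncurry P.revObstacle) P.closedStrip := by
  obtain ⟨e, he, heq⟩ := hP.exists_exponent
  have hN : ContinuousOn (uncurry P.N) P.closedStrip := by
    refine (continuousOn_weighted_primitive hP.integrableOn_weight he).congr fun q hq => ?_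
    refine intervalIntegral.integral_congr fun s hs => ?_
    rw [uIcc_of_le hq.1.2] at hs
    simp only [heq q.1 s q.2 hs.1]
  have hrev : MapsTo (fun q : ℝ × ℝ => (P.T - q.1, q.2)) P.closedStrip P.closedStrip :=
    fun q hq => ⟨⟨by linarith [hq.1.2], by linarith [hq.1.1]⟩, mem_univ _⟩
  have hNr : ContinuousOn (fun q : ℝ × ℝ => P.N (P.T - q.1) q.2) P.closedStrip :=
    hN.comp (by fun_prop : Continuous fun q : ℝ × ℝ => (P.T - q.1, q.2)).continuousOn hrev
  have hmr : ContinuousOn (fun q : ℝ × ℝ => P.m (P.T - q.1)) P.closedStrip :=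
    hP.continuousOn_m.comp (by fun_prop : Continuous fun q : ℝ × ℝ => P.T - q.1).continuousOn
      fun q hq => (hrev hq).1
  have hbase : ContinuousOn (fun q : ℝ × ℝ =>
      P.x0 - P.kappa * (P.T - q.1) - P.m (P.T - q.1) * P.z0) P.closedStrip :=
    (by fun_prop : Continuous fun q : ℝ × ℝ => P.x0 - P.kappa * (P.T - q.1)).continuousOn.sub
      (hmr.mul continuousOn_const)
  have hp := hP.p_neg
  -- The exponent 1 - p is positive, so zeros of N (as at the horizon) do no harm; the negative
  -- power p needs the base nonzero, which the budget condition supplies.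
  exact (hNr.rpow_const fun q _ => Or.inr (by linarith)).mul
    ((hbase.rpow_const fun q hq => Or.inl (by
      have := hP.budget _ (hrev hq).1
      simp only at this
      linarith)).div_const _)

end HabitModel

end

theorem mainTheorem3 (P : HabitModel) (hP : P.Admissible) :
    P.ComparisonPrinciple P.revObstacle ∧
      ∀ g : ℝ → ℝ → ℝ, ContinuousOn (uncurry g) P.closedStrip → P.ComparisonPrinciple g :=
  ⟨HabitModel.comparisonPrinciple_of_continuousOn hP.T_pos hP.lam_nonneg hP.continuousOn_revObstacle,
    fun _ hg => HabitModel.comparisonPrinciple_of_continuousOn hP.T_pos hP.lam_nonneg hg⟩
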